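/- Let $\mathbb T^2=(\mathbb R/2\pi\mathbb Z)^2$ with Lebesgue measure $dx$, and let ${\bf e}_k(x)=\frac1{2\pi}e^{\sqrt{-1}\,k\cdot x}$ for $k\in\mathbb Z^2$. Fix $\delta>0$, let $E=H^{-\delta}(\mathbb T^2)$ be the real Sobolev space of distributions $z$ with $\hat z(-k)=\overline{\hat z(k)}$ and $\sum_{k}(1+|k|^2)^{-\delta}|\hat z(k)|^2<\infty$, where $\hat z(k)=\langle z,{\bf e}_k\rangle$, let $A=(1-\Delta)^{-1}$, and let $\mu_0=N(0,A^{1+\delta})$ be the centred Gaussian probability measure on $E$ with $\int_E (l_1,z)_E(l_2,z)_E\,\mu_0(dz)=(A^{1+\delta}l_1,l_2)_E$ for $l_1,l_2\in E$. For a compact set $\Lambda\subset\mathbb R^2$ with $\Lambda=-\Lambda$ and $0$ in its interior, put $(\Pi_\Lambda z)(x)=\sum_{k\in\Lambda\cap\mathbb Z^2}\hat z(k){\bf e}_k(x)$. For $a\in\mathbb R$ with $|a|<\sqrt{4\pi}$ define the Wick cosine $$:\!\cos(az)\!:({\bf 1}_{\mathbb T^2})=\lim_{N\to\infty}\int_{\mathbb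 T^2}\cos\big(a(\Pi_{N\Lambda}z)(x)\big)\exp\Big(\frac{a^2}{2}\mathbb E^{\mu_0}\big[(\Pi_{N\Lambda}z)(x)^2\big]\Big)dx\quad\text{in }L^2(\mu_0),$$ and the Wick sine $:\!\sin(az)\!:({\bf 1}_{\mathbb T^2})$ in the same way with $\sin$ in place of $\cos$; these limits exist and do not depend on $\Lambda$. Then for all $|a|<\sqrt{4\pi}$ the function $\exp\big(-:\!\cos(az)\!:({\bf 1}_{\mathbb T^2})\big)$ belongs to $\bigcap_{p\ge1}L^p(\mu_0)$, that is, for every real $p\ge1$, $$\int_E\exp\big(-p:\!\cos(az)\!:({\bf 1}_{\mathbb T^2})\big)\,\mu_0(dz)<\infty,$$ and $$Z^{(a)}_{\sf cos}:=\int_E\exp\big(-:\!\cos(az)\!:({\bf 1}_{\mathbb T^2})\big)\,\mu_0(dz)>0.$$ The same statements hold with $:\!\sin(az)\!:({\bf 1}_{\mathbb T^2})$ in place of $:\!\cos(az)\!:({\bf 1}_{\mathbb T^2})$. -/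

import Mathlib

open MeasureTheory

namespace WickTrig

noncomputable section

open ProbabilityTheory Filter Topology
open scoped ENNReal NNReal ContDiff Pointwise ComplexConjugate

instance fact_two_pi_pos : Fact (0 < 2 * Real.pi) := ⟨Real.two_pi_pos⟩

/-- The torus `(ℝ / 2πℤ)²`; its `volume` is Lebesgue measure, of total mass `4π²`. -/
abbrev Torus : Type := AddCircle (2 * Real.pi) × AddCircle (2 * Real.pi)

/-- The space of smooth complex functions on the torus: those whose lift to `ℝ²` is smooth. -/
def TestFunction : Submodule ℂ (Torus → ℂ) where
  carrier := {φ | ContDiff ℝ ∞ (fun p : ℝ × ℝ =>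
    φ ((p.1 : AddCircle (2 * Real.pi)), (p.2 : AddCircle (2 * Real.pi))))}
  add_mem' := by
    intro f g hf hg
    simp only [Set.mem_ofPred_eq] at hf hg ⊢
    exact ContDiff.add (𝕜 := ℝ) hf hg
  zero_mem' := by
    simp only [Set.mem_ofPred_eq]
    exact contDiff_const
  smul_mem' := by
    intro c f hf
    simp only [Set.mem_ofPred_eq] at hf ⊢
    exact ContDiff.const_smul (𝕜 := ℝ) c hf

/-- The mixed partial derivative `∂₁ⁱ ∂₂ʲ φ` at the point with coordinates `(x, y)`. -/
def partialDeriv (i j : ℕ) (φ : Torus → ℂ) (x y : ℝ) : ℂ :=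
  iteratedDeriv i (fun s : ℝ => iteratedDeriv j
    (fun t : ℝ => φ ((s : AddCircle (2 * Real.pi)), (t : AddCircle (2 * Real.pi)))) y) x

/-- A linear functional on smooth functions is a distribution if it is bounded by finitely many
derivatives: `|u(φ)| ≤ C max_{i + j ≤ N} max_x |∂₁ⁱ ∂₂ʲ φ(x)|`. -/
def IsDistribution (u : TestFunction →ₗ[ℂ] ℂ) : Prop :=
  ∃ (N : ℕ) (C : ℝ), ∀ (φ : TestFunction) (B : ℝ),
    (∀ i j : ℕ, i + j ≤ N → ∀ x y : ℝ, ‖partialDeriv i j φ x y‖ ≤ B) → ‖u φ‖ ≤ C * B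

/-- `1 + |k|²`. -/
def lam (k : ℤ × ℤ) : ℝ := 1 + ((k.1 : ℝ) ^ 2 + (k.2 : ℝ) ^ 2)

/-- `𝐞_k(x) = (2π)⁻¹ exp(i k·x)`; on the circle of length `2π`, `fourier n x` is `exp(i n x)`. -/
def e (k : ℤ × ℤ) (x : Torus) : ℂ :=
  (2 * (Real.pi : ℂ))⁻¹ * (fourier k.1 x.1 * fourier k.2 x.2)

theorem e_smooth (k : ℤ × ℤ) : e k ∈ TestFunction := by
  change ContDiff ℝ ∞ _
  unfold e
  simp only [fourier_coe_apply]
  have h1 : ContDiff ℝ ∞ (fun p : ℝ × ℝ => (p.1 : ℂ)) :=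
    Complex.ofRealCLM.contDiff.comp contDiff_fst
  have h2 : ContDiff ℝ ∞ (fun p : ℝ × ℝ => (p.2 : ℂ)) :=
    Complex.ofRealCLM.contDiff.comp contDiff_snd
  fun_prop

/-- The Fourier coefficient `û(k) = ⟨u, 𝐞_k⟩` of a distribution. The pairing extends
`∫ f(x) conj(φ(x)) dx`, so that `û(k)` is the value of the linear functional `u` at
`conj 𝐞_k = 𝐞_{-k}`. -/
def coeffOf (u : TestFunction →ₗ[ℂ] ℂ) (k : ℤ × ℤ) : ℂ := u ⟨e (-k), e_smooth (-k)⟩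

/-- The real Sobolev space `H^s` of the torus: the distributions `u` with
`∑ (1 + |k|²)^s |û(k)|² < ∞` and `û(-k) = conj û(k)`. -/
structure Sobolev (s : ℝ) where
  toFun : TestFunction →ₗ[ℂ] ℂ
  isDistribution : IsDistribution toFun
  summable : Summable fun k => lam k ^ s * ‖coeffOf toFun k‖ ^ 2
  real : ∀ k, coeffOf toFun (-k) = conj (coeffOf toFun k)

namespace Sobolev

variable {s : ℝ}

/-- The Fourier coefficients of an element of `H^s`. -/
def coeff (u : Sobolev s) (k : ℤ × ℤ) : ℂ := coeffOf u.toFun k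

/-- `(u, v)_{H^s} = ∑ (1 + |k|²)^s û(k) v̂(-k)` (the sum is real). -/
def innerProd (u v : Sobolev s) : ℝ :=
  (∑' k : ℤ × ℤ, ((lam k ^ s : ℝ) : ℂ) * (u.coeff k * v.coeff (-k))).re

theorem lam_pos (k : ℤ × ℤ) : 0 < lam k := by unfold lam; positivity

theorem memlp (u : Sobolev s) :
    Memℓp (fun k => ((lam k ^ (s / 2) : ℝ) : ℂ) * u.coeff k) 2 := by
  rw [memℓp_gen_iff (by norm_num)]
  refine u.summable.congr fun k => ?_
  have := lam_pos k
  simp only [ENNReal.toReal_ofNat, Real.rpow_ofNat, norm_mul, Complex.norm_real, mul_pow]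
  rw [Real.norm_of_nonneg (by positivity), ← Real.rpow_natCast (lam k ^ (s / 2)),
    ← Real.rpow_mul this.le]
  norm_num [coeff]

/-- The isometric embedding `u ↦ ((1 + |k|²)^{s/2} û(k))_k` of `H^s` into `ℓ²`. -/
def toL2 (u : Sobolev s) : lp (fun _ : ℤ × ℤ => ℂ) 2 :=
  ⟨fun k => ((lam k ^ (s / 2) : ℝ) : ℂ) * u.coeff k, u.memlp⟩

/-- The topology of the Hilbert norm of `H^s`. -/
instance : TopologicalSpace (Sobolev s) := TopologicalSpace.induced toL2 inferInstance

/-- The Borel `σ`-algebra of `H^s`. -/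
instance : MeasurableSpace (Sobolev s) := borel (Sobolev s)

instance : BorelSpace (Sobolev s) := ⟨rfl⟩

end Sobolev

open Sobolev

/-- `(A^p u, v)_{H^s}`, where `A = (1 - Δ)⁻¹` acts on `H^s` by multiplying the `k`-th Fourier
coefficient by `(1 + |k|²)⁻¹`. -/
def innerApow {s : ℝ} (p : ℝ) (u v : Sobolev s) : ℝ :=
  (∑' k : ℤ × ℤ, ((lam k ^ s : ℝ) : ℂ) *
    ((((lam k)⁻¹ ^ p : ℝ) : ℂ) * u.coeff k * v.coeff (-k))).re

/-- `μ` is the centred Gaussian measure `N(0, A^{1+δ})` on `E = H^{-δ}`: it is a probability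
measure under which every functional `(l, ·)_E` has the law `N(0, (A^{1+δ} l, l)_E)`. -/
def IsFreeField (δ : ℝ) (μ : Measure (Sobolev (-δ))) : Prop :=
  IsProbabilityMeasure μ ∧ ∀ l : Sobolev (-δ),
    μ.map (fun z => innerProd l z) = gaussianReal 0 (innerApow (1 + δ) l l).toNNReal

/-! Auxiliary facts for the existence of the Gaussian measure. -/

theorem circle_decay (h : AddCircle (2 * Real.pi) → ℂ)
    (hh : ContDiff ℝ ∞ (fun t : ℝ => h t)) (n : ℤ) (N : ℕ) (B : ℝ)
    (hB : ∀ x, ‖iteratedDeriv N (fun t : ℝ => h t) x‖ ≤ B) :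
    |(n : ℝ)| ^ N * ‖∫ x, fourier n x * h x‖ ≤ 2 * Real.pi * B := by
  have key : ∀ f : ℝ → ℂ, ContDiff ℝ ∞ f → Function.Periodic f (2 * Real.pi) → ∀ N : ℕ,
      (-(Complex.I * n)) ^ N * ∫ x in (0)..(2 * Real.pi), Complex.exp (Complex.I * n * x) * f x
        = ∫ x in (0)..(2 * Real.pi), Complex.exp (Complex.I * n * x) * iteratedDeriv N f x := by
    intro f hf hp N
    induction N with
    | zero => simp
    | succ N ih =>
      rw [pow_succ', mul_assoc, ih]
      have hper : Function.Periodic (iteratedDeriv N f) (2 * Real.pi) := by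
        intro x
        have := iteratedDeriv_comp_add_const N f (2 * Real.pi)
        have h2 : (fun z => f (z + 2 * Real.pi)) = f := funext hp
        rw [h2] at this
        exact (congrFun this x).symm
      have hd : ∀ x, HasDerivAt (iteratedDeriv N f) (iteratedDeriv (N + 1) f x) x := by
        intro x
        rw [iteratedDeriv_succ]
        exact (hf.differentiable_iteratedDeriv N (by exact_mod_cast WithTop.coe_lt_top _) x).hasDerivAt
      have he : ∀ x : ℝ, HasDerivAt (fun x : ℝ => Complex.exp (Complex.I * n * x))
          (Complex.exp (Complex.I * n * x) * (Complex.I * n)) x := by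
        intro x
        have h1 : HasDerivAt (fun x : ℝ => Complex.I * n * (x : ℂ)) (Complex.I * n * 1) x :=
          (Complex.ofRealCLM.hasDerivAt (x := x)).const_mul _
        simpa using h1.cexp
      have hc : Continuous (iteratedDeriv (N + 1) f) :=
        hf.continuous_iteratedDeriv (N + 1) (by exact_mod_cast le_top)
      have := intervalIntegral.integral_mul_deriv_eq_deriv_mul (a := 0) (b := 2 * Real.pi)
        (fun x _ => he x) (fun x _ => hd x)
        (Continuous.intervalIntegrable (by fun_prop) _ _) (hc.intervalIntegrable _ _)
      rw [this]
      have hb : iteratedDeriv N f (2 * Real.pi) = iteratedDeriv N f 0 := by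
        simpa using hper 0
      have hexp : Complex.exp (Complex.I * n * ((2 * Real.pi : ℝ) : ℂ)) = 1 := by
        rw [Complex.exp_eq_one_iff]
        exact ⟨n, by push_cast; ring⟩
      rw [hb, hexp]
      simp only [Complex.ofReal_zero, mul_zero, Complex.exp_zero, sub_self, zero_sub]
      rw [← intervalIntegral.integral_const_mul, ← intervalIntegral.integral_neg]
      congr 1
      ext x
      ring
  have h1 : ∫ x, fourier n x * h x
      = ∫ x in (0)..(2 * Real.pi), Complex.exp (Complex.I * n * x) * h x := by
    have := AddCircle.intervalIntegral_preimage (2 * Real.pi) 0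
      (fun x : AddCircle (2 * Real.pi) => fourier n x * h x)
    rw [← this, zero_add]
    congr 1
    ext x
    rw [fourier_coe_apply]
    congr 2
    have : (Real.pi : ℂ) ≠ 0 := by exact_mod_cast Real.pi_ne_zero
    push_cast
    field_simp
  have hp : Function.Periodic (fun t : ℝ => h t) (2 * Real.pi) := by
    intro x
    simp
  have h2 := key _ hh hp N
  have h3 : |(n : ℝ)| ^ N * ‖∫ x, fourier n x * h x‖ = ‖(-(Complex.I * n)) ^ N *
      ∫ x in (0)..(2 * Real.pi), Complex.exp (Complex.I * n * x) * h x‖ := by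
    rw [norm_mul, norm_pow, norm_neg, norm_mul, Complex.norm_I, one_mul, h1,
      Complex.norm_intCast]
  rw [h3, h2]
  have := intervalIntegral.norm_integral_le_of_norm_le_const (a := 0) (b := 2 * Real.pi) (C := B)
    (f := fun x => Complex.exp (Complex.I * n * x) * iteratedDeriv N (fun t : ℝ => h t) x)
    (by
      intro x _
      rw [norm_mul]
      have : ‖Complex.exp (Complex.I * n * x)‖ = 1 := by
        rw [show Complex.I * n * x = ((n * x : ℝ) : ℂ) * Complex.I by push_cast; ring]
        exact Complex.norm_exp_ofReal_mul_I _
      rw [this, one_mul]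
      exact hB x)
  rw [sub_zero, abs_of_pos Real.two_pi_pos] at this
  linarith

theorem testFunction_continuous (φ : TestFunction) : Continuous (φ : Torus → ℂ) := by
  have h : ContDiff ℝ ∞ (fun p : ℝ × ℝ => (φ : Torus → ℂ)
    ((p.1 : AddCircle (2 * Real.pi)), (p.2 : AddCircle (2 * Real.pi)))) := φ.2
  have q : IsOpenQuotientMap (fun x : ℝ => (x : AddCircle (2 * Real.pi))) :=
    QuotientAddGroup.isOpenQuotientMap_mk
  exact (q.prodMap q).isQuotientMap.continuous_iff.2 h.continuous

/-- The integral of `𝐞_k φ` over the torus. -/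
def fint (k : ℤ × ℤ) (φ : Torus → ℂ) : ℂ := ∫ x, e k x * φ x

theorem e_continuous (k : ℤ × ℤ) : Continuous (e k) := by
  unfold e; fun_prop

theorem norm_fourier_one (n : ℤ) (x : AddCircle (2 * Real.pi)) : ‖fourier n x‖ = 1 := by
  rw [fourier_apply]; exact Circle.norm_coe _

theorem fint_integrable (k : ℤ × ℤ) (φ : TestFunction) :
    Integrable (fun x => e k x * (φ : Torus → ℂ) x) := by
  have : Continuous (fun x => e k x * (φ : Torus → ℂ) x) :=
    (e_continuous k).mul (testFunction_continuous φ)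
  exact this.integrable_of_hasCompactSupport (HasCompactSupport.of_compactSpace _)

theorem fint_bound0 (k : ℤ × ℤ) (φ : TestFunction) (B : ℝ)
    (hB : ∀ x y : ℝ, ‖(φ : Torus → ℂ) ((x : AddCircle (2 * Real.pi)), (y : AddCircle (2 * Real.pi)))‖ ≤ B) :
    ‖fint k φ‖ ≤ 2 * Real.pi * B := by
  have hB' : ∀ x : Torus, ‖e k x * (φ : Torus → ℂ) x‖ ≤ (2 * Real.pi)⁻¹ * B := by
    rintro ⟨x, y⟩
    induction x using QuotientAddGroup.induction_on with | _ x => 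
    induction y using QuotientAddGroup.induction_on with | _ y =>
    rw [norm_mul]
    have : ‖e k ((x : AddCircle (2 * Real.pi)), (y : AddCircle (2 * Real.pi)))‖ = (2 * Real.pi)⁻¹ := by
      unfold e
      rw [norm_mul, norm_mul, norm_fourier_one, norm_fourier_one]
      simp [abs_of_pos Real.pi_pos]
    have h2 := hB x y
    exact mul_le_mul this.le h2 (norm_nonneg _) (by positivity)
  have := norm_integral_le_of_norm_le_const (μ := (volume : Measure Torus)) (ae_of_all _ hB')
  refine this.trans (le_of_eq ?_)
  have hv : (volume : Measure Torus).real Set.univ = (2 * Real.pi) * (2 * Real.pi) := by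
    rw [measureReal_def, ← Set.univ_prod_univ, Measure.volume_eq_prod, Measure.prod_prod,
      AddCircle.measure_univ, ENNReal.toReal_mul, ENNReal.toReal_ofReal Real.two_pi_pos.le]
  rw [hv]
  have := Real.pi_ne_zero
  field_simp

theorem fint_bound2 (k : ℤ × ℤ) (φ : TestFunction) (N : ℕ) (B : ℝ)
    (hB : ∀ x y : ℝ, ‖partialDeriv 0 N φ x y‖ ≤ B) :
    |(k.2 : ℝ)| ^ N * ‖fint k φ‖ ≤ 2 * Real.pi * B := by
  have h1 : fint k φ = ∫ x, (2 * (Real.pi : ℂ))⁻¹ * fourier k.1 x *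
      ∫ y, fourier k.2 y * (φ : Torus → ℂ) (x, y) := by
    unfold fint
    rw [Measure.volume_eq_prod, integral_prod _ (fint_integrable k φ)]
    congr 1
    ext x
    rw [← integral_const_mul]
    congr 1
    ext y
    simp only [e]
    ring
  have hb : ∀ x, ‖(|(k.2 : ℝ)| ^ N : ℂ) * ((2 * (Real.pi : ℂ))⁻¹ * fourier k.1 x *
      ∫ y, fourier k.2 y * (φ : Torus → ℂ) (x, y))‖ ≤ B := by
    intro x
    induction x using QuotientAddGroup.induction_on with | _ x => 
    have hsm : ContDiff ℝ ∞ (fun p : ℝ × ℝ => (φ : Torus → ℂ)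
      ((p.1 : AddCircle (2 * Real.pi)), (p.2 : AddCircle (2 * Real.pi)))) := φ.2
    have := circle_decay (fun y => (φ : Torus → ℂ) ((x : AddCircle (2 * Real.pi)), y))
      (hsm.comp (contDiff_prodMk_right x)) k.2 N B (by
        intro y
        simpa [partialDeriv] using hB x y)
    rw [norm_mul, norm_mul, norm_mul, norm_fourier_one]
    have h3 : ‖(|(k.2 : ℝ)| ^ N : ℂ)‖ = |(k.2 : ℝ)| ^ N := by simp
    have h4 : ‖(2 * (Real.pi : ℂ))⁻¹‖ = (2 * Real.pi)⁻¹ := by simp [abs_of_pos Real.pi_pos]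
    rw [h3, h4]
    calc _ = (2 * Real.pi)⁻¹ * (|(k.2 : ℝ)| ^ N * ‖∫ y, fourier k.2 y *
          (φ : Torus → ℂ) ((x : AddCircle (2 * Real.pi)), y)‖) := by ring
      _ ≤ (2 * Real.pi)⁻¹ * (2 * Real.pi * B) := by gcongr
      _ = B := by have := Real.pi_ne_zero; field_simp
  have := norm_integral_le_of_norm_le_const
    (μ := (volume : Measure (AddCircle (2 * Real.pi)))) (ae_of_all _ hb)
  rw [integral_const_mul, ← h1, norm_mul, measureReal_def, AddCircle.measure_univ,
    ENNReal.toReal_ofReal Real.two_pi_pos.le] at this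
  have h3 : ‖(|(k.2 : ℝ)| ^ N : ℂ)‖ = |(k.2 : ℝ)| ^ N := by simp
  rw [h3] at this
  linarith

theorem fint_bound1 (k : ℤ × ℤ) (φ : TestFunction) (N : ℕ) (B : ℝ)
    (hB : ∀ x y : ℝ, ‖partialDeriv N 0 φ x y‖ ≤ B) :
    |(k.1 : ℝ)| ^ N * ‖fint k φ‖ ≤ 2 * Real.pi * B := by
  have h1 : fint k φ = ∫ y, (2 * (Real.pi : ℂ))⁻¹ * fourier k.2 y *
      ∫ x, fourier k.1 x * (φ : Torus → ℂ) (x, y) := by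
    unfold fint
    rw [Measure.volume_eq_prod, integral_prod_symm _ (fint_integrable k φ)]
    congr 1
    ext x
    rw [← integral_const_mul]
    congr 1
    ext y
    simp only [e]
    ring
  have hb : ∀ y, ‖(|(k.1 : ℝ)| ^ N : ℂ) * ((2 * (Real.pi : ℂ))⁻¹ * fourier k.2 y *
      ∫ x, fourier k.1 x * (φ : Torus → ℂ) (x, y))‖ ≤ B := by
    intro y
    induction y using QuotientAddGroup.induction_on with | _ y => 
    have hsm : ContDiff ℝ ∞ (fun p : ℝ × ℝ => (φ : Torus → ℂ)
      ((p.1 : AddCircle (2 * Real.pi)), (p.2 : AddCircle (2 * Real.pi)))) := φ.2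
    have := circle_decay (fun x => (φ : Torus → ℂ) (x, (y : AddCircle (2 * Real.pi))))
      (hsm.comp (contDiff_prodMk_left y)) k.1 N B (by
        intro x
        simpa [partialDeriv] using hB x y)
    rw [norm_mul, norm_mul, norm_mul, norm_fourier_one]
    have h3 : ‖(|(k.1 : ℝ)| ^ N : ℂ)‖ = |(k.1 : ℝ)| ^ N := by simp
    have h4 : ‖(2 * (Real.pi : ℂ))⁻¹‖ = (2 * Real.pi)⁻¹ := by simp [abs_of_pos Real.pi_pos]
    rw [h3, h4]
    calc _ = (2 * Real.pi)⁻¹ * (|(k.1 : ℝ)| ^ N * ‖∫ x, fourier k.1 x *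
          (φ : Torus → ℂ) (x, (y : AddCircle (2 * Real.pi)))‖) := by ring
      _ ≤ (2 * Real.pi)⁻¹ * (2 * Real.pi * B) := by gcongr
      _ = B := by have := Real.pi_ne_zero; field_simp
  have := norm_integral_le_of_norm_le_const
    (μ := (volume : Measure (AddCircle (2 * Real.pi)))) (ae_of_all _ hb)
  rw [integral_const_mul, ← h1, norm_mul, measureReal_def, AddCircle.measure_univ,
    ENNReal.toReal_ofReal Real.two_pi_pos.le] at this
  have h3 : ‖(|(k.1 : ℝ)| ^ N : ℂ)‖ = |(k.1 : ℝ)| ^ N := by simp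
  rw [h3] at this
  linarith


theorem lam_one_le (k : ℤ × ℤ) : 1 ≤ lam k := by
  unfold lam
  nlinarith [sq_nonneg (k.1 : ℝ), sq_nonneg (k.2 : ℝ)]

theorem lam_neg (k : ℤ × ℤ) : lam (-k) = lam k := by simp [lam]

theorem fint_decay (m : ℕ) (φ : TestFunction) (B : ℝ)
    (hB : ∀ i j : ℕ, i + j ≤ 2 * m → ∀ x y : ℝ, ‖partialDeriv i j φ x y‖ ≤ B) (k : ℤ × ℤ) :
    lam k ^ m * ‖fint k φ‖ ≤ 3 ^ m * (3 * (2 * Real.pi * B)) := by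
  have b0 := fint_bound0 k φ B (by
    intro x y
    simpa [partialDeriv] using hB 0 0 (by omega) x y)
  have b1 := fint_bound1 k φ (2 * m) B (hB (2 * m) 0 (by omega))
  have b2 := fint_bound2 k φ (2 * m) B (hB 0 (2 * m) (by omega))
  have hl : lam k ^ m ≤ 3 ^ m * (1 + |(k.1 : ℝ)| ^ (2 * m) + |(k.2 : ℝ)| ^ (2 * m)) := by
    have hmax : lam k ≤ 3 * max 1 (max (|(k.1 : ℝ)| ^ 2) (|(k.2 : ℝ)| ^ 2)) := by
      have h1 := le_max_left 1 (max (|(k.1 : ℝ)| ^ 2) (|(k.2 : ℝ)| ^ 2))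
      have h2 := le_max_right 1 (max (|(k.1 : ℝ)| ^ 2) (|(k.2 : ℝ)| ^ 2))
      have h3 := le_max_left (|(k.1 : ℝ)| ^ 2) (|(k.2 : ℝ)| ^ 2)
      have h4 := le_max_right (|(k.1 : ℝ)| ^ 2) (|(k.2 : ℝ)| ^ 2)
      unfold lam
      rw [← sq_abs (k.1 : ℝ), ← sq_abs (k.2 : ℝ)]
      linarith
    calc lam k ^ m ≤ (3 * max 1 (max (|(k.1 : ℝ)| ^ 2) (|(k.2 : ℝ)| ^ 2))) ^ m :=
          pow_le_pow_left₀ (lam_pos k).le hmax m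
      _ = 3 ^ m * (max 1 (max (|(k.1 : ℝ)| ^ 2) (|(k.2 : ℝ)| ^ 2))) ^ m := mul_pow _ _ _
      _ ≤ _ := by
        gcongr
        have p1 : 0 ≤ |(k.1 : ℝ)| ^ (2 * m) := by positivity
        have p2 : 0 ≤ |(k.2 : ℝ)| ^ (2 * m) := by positivity
        rcases max_choice 1 (max (|(k.1 : ℝ)| ^ 2) (|(k.2 : ℝ)| ^ 2)) with h | h <;> rw [h]
        · rw [one_pow]; linarith
        · rcases max_choice (|(k.1 : ℝ)| ^ 2) (|(k.2 : ℝ)| ^ 2) with h | h <;>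
            rw [h, ← pow_mul] <;> linarith
  calc lam k ^ m * ‖fint k φ‖
      ≤ 3 ^ m * (1 + |(k.1 : ℝ)| ^ (2 * m) + |(k.2 : ℝ)| ^ (2 * m)) * ‖fint k φ‖ := by gcongr
    _ = 3 ^ m * (‖fint k φ‖ + |(k.1 : ℝ)| ^ (2 * m) * ‖fint k φ‖
        + |(k.2 : ℝ)| ^ (2 * m) * ‖fint k φ‖) := by ring
    _ ≤ _ := by gcongr; linarith

theorem summable_lam_rpow (r : ℝ) (hr : 1 < r) : Summable fun k => lam k ^ (-r) := by
  have h1 : Summable fun n : ℤ => (1 + (n : ℝ) ^ 2) ^ (-(r / 2)) := by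
    refine Summable.of_norm_bounded_eventually (g := fun n : ℤ => |(n : ℝ)| ^ (-r))
      (Real.summable_abs_int_rpow hr) ?_
    have : ∀ᶠ n : ℤ in cofinite, n ≠ 0 := by
      rw [eventually_cofinite]; simp
    filter_upwards [this] with n hn
    have hn' : 0 < |(n : ℝ)| := by simpa using hn
    rw [Real.norm_of_nonneg (by positivity), show -r = 2 * (-(r / 2)) by ring,
      Real.rpow_mul hn'.le]
    apply Real.rpow_le_rpow_of_nonpos (by positivity)
    · rw [Real.rpow_two, sq_abs]; linarith
    · linarith
  have h2 := h1.mul_of_nonneg h1 (fun n => by positivity) (fun n => by positivity)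
  refine Summable.of_nonneg_of_le (fun k => (Real.rpow_pos_of_pos (lam_pos k) _).le) ?_ h2
  intro k
  rw [← Real.mul_rpow (by positivity) (by positivity), show -r = 2 * (-(r / 2)) by ring,
    Real.rpow_mul (lam_pos k).le]
  apply Real.rpow_le_rpow_of_nonpos (by positivity)
  · rw [Real.rpow_two]
    unfold lam
    nlinarith [sq_nonneg (k.1 : ℝ), sq_nonneg (k.2 : ℝ), sq_nonneg ((k.1 : ℝ) * k.2),
      sq_nonneg ((k.1 : ℝ) ^ 2), sq_nonneg ((k.2 : ℝ) ^ 2)]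
  · linarith

theorem contDiff_iteratedDeriv_snd (F : ℝ × ℝ → ℂ) (hF : ContDiff ℝ ∞ F) (j : ℕ) :
    ContDiff ℝ ∞ (fun p : ℝ × ℝ => iteratedDeriv j (fun t => F (p.1, t)) p.2) := by
  induction j with
  | zero => simpa using hF
  | succ j ih =>
    have h1 : ∀ p : ℝ × ℝ, iteratedDeriv (j + 1) (fun t => F (p.1, t)) p.2 =
        fderiv ℝ (fun p : ℝ × ℝ => iteratedDeriv j (fun t => F (p.1, t)) p.2) p (0, 1) := by
      intro p
      rw [iteratedDeriv_succ]
      have hd : HasFDerivAt (fun p : ℝ × ℝ => iteratedDeriv j (fun t => F (p.1, t)) p.2)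
          (fderiv ℝ (fun p : ℝ × ℝ => iteratedDeriv j (fun t => F (p.1, t)) p.2) p) (p.1, p.2) :=
        (ih.differentiable (by simp) p).hasFDerivAt
      have hl : HasDerivAt (fun t : ℝ => (p.1, t)) ((0 : ℝ), (1 : ℝ)) p.2 :=
        (hasDerivAt_const _ _).prodMk (hasDerivAt_id _)
      exact (hd.comp_hasDerivAt p.2 hl).deriv
    simp_rw [h1]
    exact (ih.fderiv_right (m := ∞) (by simp)).clm_apply contDiff_const

theorem exists_bound_one (i j : ℕ) (φ : TestFunction) :
    ∃ B, ∀ x y : ℝ, ‖partialDeriv i j φ x y‖ ≤ B := by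
  have hsm : ContDiff ℝ ∞ (fun p : ℝ × ℝ => (φ : Torus → ℂ)
      ((p.1 : AddCircle (2 * Real.pi)), (p.2 : AddCircle (2 * Real.pi)))) := φ.2
  have h1 := contDiff_iteratedDeriv_snd _ hsm j
  have h2 := contDiff_iteratedDeriv_snd _ (h1.comp (contDiff_snd.prodMk contDiff_fst)) i
  have hc : Continuous (fun p : ℝ × ℝ => partialDeriv i j φ p.1 p.2) :=
    (h2.comp (contDiff_snd.prodMk contDiff_fst)).continuous
  obtain ⟨B, hB⟩ := ((isCompact_Icc (a := (0 : ℝ)) (b := 2 * Real.pi)).prod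
    (isCompact_Icc (a := (0 : ℝ)) (b := 2 * Real.pi))).exists_bound_of_continuousOn hc.continuousOn
  have hp1 : ∀ y, Function.Periodic (fun x => partialDeriv i j φ x y) (2 * Real.pi) := by
    intro y x
    have := iteratedDeriv_comp_add_const i (fun s : ℝ => iteratedDeriv j
      (fun t : ℝ => (φ : Torus → ℂ) ((s : AddCircle (2 * Real.pi)), (t : AddCircle (2 * Real.pi)))) y)
      (2 * Real.pi)
    simp only [AddCircle.coe_add_period] at this
    exact (congrFun this x).symm
  have hp2 : ∀ x, Function.Periodic (fun y => partialDeriv i j φ x y) (2 * Real.pi) := by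
    intro x y
    unfold partialDeriv
    refine congrArg (fun f => iteratedDeriv i f x) (funext fun s => ?_)
    have := iteratedDeriv_comp_add_const j
      (fun t : ℝ => (φ : Torus → ℂ) ((s : AddCircle (2 * Real.pi)), (t : AddCircle (2 * Real.pi))))
      (2 * Real.pi)
    simp only [AddCircle.coe_add_period] at this
    exact (congrFun this y).symm
  refine ⟨B, fun x y => ?_⟩
  obtain ⟨x', hx', hx⟩ := (hp1 y).exists_mem_Ico₀ Real.two_pi_pos x
  obtain ⟨y', hy', hy⟩ := (hp2 x').exists_mem_Ico₀ Real.two_pi_pos y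
  rw [hx, hy]
  exact hB (x', y') ⟨Set.Ico_subset_Icc_self hx', Set.Ico_subset_Icc_self hy'⟩

theorem exists_bound (m : ℕ) (φ : TestFunction) :
    ∃ B, ∀ i j : ℕ, i + j ≤ m → ∀ x y : ℝ, ‖partialDeriv i j φ x y‖ ≤ B := by
  choose b hb using fun i j => exists_bound_one i j φ
  refine ⟨∑ i ∈ Finset.range (m + 1), ∑ j ∈ Finset.range (m + 1), b i j, fun i j hij x y => ?_⟩
  have hnn : ∀ i j, 0 ≤ b i j := fun i j => (norm_nonneg _).trans (hb i j 0 0)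
  refine (hb i j x y).trans ?_
  refine (Finset.single_le_sum (f := fun j => b i j) (fun j _ => hnn i j)
    (Finset.mem_range.2 (by omega : j < m + 1))).trans ?_
  exact Finset.single_le_sum (f := fun i => ∑ j ∈ Finset.range (m + 1), b i j)
    (fun i _ => Finset.sum_nonneg fun j _ => hnn i j) (Finset.mem_range.2 (by omega : i < m + 1))

theorem coeff_term_bound {s : ℝ} (c : ℤ × ℤ → ℂ) (hc : Summable fun k => lam k ^ s * ‖c k‖ ^ 2) :
    ∃ (m : ℕ) (C : ℝ), 0 ≤ C ∧ ∀ (φ : TestFunction) (B : ℝ),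
      (∀ i j : ℕ, i + j ≤ 2 * m → ∀ x y : ℝ, ‖partialDeriv i j φ x y‖ ≤ B) →
      ∀ k, ‖c k * fint k φ‖ ≤ C * B * lam k ^ (-2 : ℝ) := by
  obtain ⟨m, hm⟩ := exists_nat_ge (2 - s / 2)
  set S := ∑' k, lam k ^ s * ‖c k‖ ^ 2 with hS
  have hnn : ∀ k, 0 ≤ lam k ^ s * ‖c k‖ ^ 2 := fun k =>
    mul_nonneg (Real.rpow_pos_of_pos (lam_pos k) _).le (sq_nonneg _)
  refine ⟨m, Real.sqrt S * (3 ^ m * (3 * (2 * Real.pi))), by positivity, ?_⟩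
  intro φ B hB k
  have hlk := lam_pos k
  have h1 : lam k ^ (s / 2) * ‖c k‖ ≤ Real.sqrt S := by
    apply Real.le_sqrt_of_sq_le
    rw [mul_pow, ← Real.rpow_natCast (lam k ^ (s / 2)), ← Real.rpow_mul hlk.le]
    norm_num
    exact hc.le_tsum k (fun j _ => hnn j)
  have h2 := fint_decay m φ B hB k
  have h3 : (lam k ^ (s / 2) * ‖c k‖) * (lam k ^ m * ‖fint k φ‖)
      ≤ Real.sqrt S * (3 ^ m * (3 * (2 * Real.pi * B))) := by gcongr
  have h4 : lam k ^ (2 : ℝ) ≤ lam k ^ (s / 2) * lam k ^ m := by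
    rw [← Real.rpow_natCast, ← Real.rpow_add hlk]
    exact Real.rpow_le_rpow_of_exponent_le (lam_one_le k) (by linarith)
  rw [norm_mul, Real.rpow_neg hlk.le, ← div_eq_mul_inv, le_div_iff₀ (by positivity)]
  calc ‖c k‖ * ‖fint k φ‖ * lam k ^ (2 : ℝ)
      ≤ ‖c k‖ * ‖fint k φ‖ * (lam k ^ (s / 2) * lam k ^ m) := by gcongr
    _ = (lam k ^ (s / 2) * ‖c k‖) * (lam k ^ m * ‖fint k φ‖) := by ring
    _ ≤ _ := h3
    _ = _ := by ring

theorem summable_coeff {s : ℝ} (c : ℤ × ℤ → ℂ) (hc : Summable fun k => lam k ^ s * ‖c k‖ ^ 2)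
    (φ : TestFunction) : Summable fun k => c k * fint k φ := by
  obtain ⟨m, C, _, h⟩ := coeff_term_bound c hc
  obtain ⟨B, hB⟩ := exists_bound (2 * m) φ
  exact Summable.of_norm_bounded ((summable_lam_rpow 2 (by norm_num)).mul_left _) (h φ B hB)

theorem fint_e (k j : ℤ × ℤ) : fint k (e j) = if k = -j then 1 else 0 := by
  have h1 : ∀ n m : ℤ, ∫ x : AddCircle (2 * Real.pi), fourier n x * fourier m x
      = if n = -m then (2 * (Real.pi : ℂ)) else 0 := by
    intro n m
    have h0 : ∀ x : AddCircle (2 * Real.pi),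
        fourier n x * fourier m x = fourier (n + m) x * (1 : ℂ) := fun x => by
      rw [fourier_add, mul_one]
    simp_rw [h0]
    by_cases h : n = -m
    · have : n + m = 0 := by omega
      simp [h, measureReal_def, AddCircle.measure_univ, Real.pi_pos.le]
    · have hd := circle_decay (fun _ => (1 : ℂ)) contDiff_const (n + m) 1 0 (by simp)
      have hne : 0 < |((n + m : ℤ) : ℝ)| := by
        rw [abs_pos]
        exact_mod_cast (by omega : n + m ≠ 0)
      rw [if_neg h, ← norm_le_zero_iff]
      rw [pow_one, mul_zero] at hd
      exact nonpos_of_mul_nonpos_right hd hne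
  unfold fint e
  have : ∀ x : Torus, (2 * (Real.pi : ℂ))⁻¹ * (fourier k.1 x.1 * fourier k.2 x.2) *
      ((2 * (Real.pi : ℂ))⁻¹ * (fourier j.1 x.1 * fourier j.2 x.2)) =
      ((2 * (Real.pi : ℂ))⁻¹ * (fourier k.1 x.1 * fourier j.1 x.1)) *
      ((2 * (Real.pi : ℂ))⁻¹ * (fourier k.2 x.2 * fourier j.2 x.2)) := fun x => by ring
  simp_rw [this]
  rw [Measure.volume_eq_prod, integral_prod_mul
    (fun x => (2 * (Real.pi : ℂ))⁻¹ * (fourier k.1 x * fourier j.1 x))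
    (fun x => (2 * (Real.pi : ℂ))⁻¹ * (fourier k.2 x * fourier j.2 x)),
    integral_const_mul, integral_const_mul, h1, h1]
  have : (Real.pi : ℂ) ≠ 0 := by exact_mod_cast Real.pi_ne_zero
  by_cases a : k.1 = -j.1 <;> by_cases b : k.2 = -j.2 <;> simp [a, b, Prod.ext_iff]
  field_simp

/-- The distribution with prescribed Fourier coefficients. -/
def ofCoeff {s : ℝ} (c : ℤ × ℤ → ℂ) (hc : Summable fun k => lam k ^ s * ‖c k‖ ^ 2)
    (hr : ∀ k, c (-k) = conj (c k)) : Sobolev s :=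
  let u : TestFunction →ₗ[ℂ] ℂ :=
    { toFun := fun φ => ∑' k, c k * fint k φ
      map_add' := by
        intro φ ψ
        rw [← (summable_coeff c hc φ).tsum_add (summable_coeff c hc ψ)]
        congr 1
        ext k
        rw [← mul_add]
        congr 1
        unfold fint
        rw [← integral_add (fint_integrable k φ) (fint_integrable k ψ)]
        congr 1
        ext x
        simp [mul_add]
      map_smul' := by
        intro a φ
        rw [RingHom.id_apply, smul_eq_mul, ← tsum_mul_left]
        congr 1
        ext k
        rw [mul_left_comm]
        congr 1
        unfold fint
        rw [← integral_const_mul]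
        congr 1
        ext x
        simp [mul_left_comm] }
  have hu : ∀ k, coeffOf u k = c k := by
    intro k
    change ∑' j, c j * fint j (e (-k)) = c k
    simp_rw [fint_e]
    rw [tsum_eq_single k]
    · simp
    · intro j hj
      simp [hj]
  { toFun := u
    isDistribution := by
      obtain ⟨m, C, hC, h⟩ := coeff_term_bound c hc
      refine ⟨2 * m, C * ∑' k, lam k ^ (-2 : ℝ), fun φ B hB => ?_⟩
      have hs := (summable_lam_rpow 2 (by norm_num)).mul_left (C * B)
      have := tsum_of_norm_bounded hs.hasSum (h φ B hB)
      rw [tsum_mul_left] at this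
      change ‖∑' k, c k * fint k φ‖ ≤ _
      linarith
    summable := by simpa only [hu] using hc
    real := by simpa only [hu] using hr }

theorem coeff_ofCoeff {s : ℝ} (c : ℤ × ℤ → ℂ) (hc : Summable fun k => lam k ^ s * ‖c k‖ ^ 2)
    (hr : ∀ k, c (-k) = conj (c k)) (k : ℤ × ℤ) : (ofCoeff c hc hr).coeff k = c k := by
  change ∑' j, c j * fint j (e (-k)) = c k
  simp_rw [fint_e]
  rw [tsum_eq_single k]
  · simp
  · intro j hj
    simp [hj]


/-- A Gaussian random field is given on the product space by its Fourier coefficients. -/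
def rawCoeff (w : ℤ × ℤ → ℝ) (k : ℤ × ℤ) : ℂ :=
  ((lam k ^ (-(1 / 2) : ℝ) : ℝ) : ℂ) *
    (((w k + w (-k)) / 2 : ℝ) + Complex.I * ((w k - w (-k)) / 2 : ℝ))

def noise : Measure (ℤ × ℤ → ℝ) := Measure.infinitePi fun _ => gaussianReal 0 1

instance : IsProbabilityMeasure noise := by unfold noise; infer_instance

def goodSet (δ : ℝ) : Set (ℤ × ℤ → ℝ) := {w | Summable fun k => lam k ^ (-(1 + δ)) * w k ^ 2}

theorem measurableSet_goodSet (δ : ℝ) : MeasurableSet (goodSet δ) := by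
  have : goodSet δ = {w | ∑' k, ENNReal.ofReal (lam k ^ (-(1 + δ)) * w k ^ 2) < ⊤} := by
    ext w
    have hnn : ∀ k, 0 ≤ lam k ^ (-(1 + δ)) * w k ^ 2 := fun k =>
      mul_nonneg (Real.rpow_pos_of_pos (lam_pos k) _).le (sq_nonneg _)
    constructor
    · intro h
      exact lt_top_iff_ne_top.2 (Summable.tsum_ofReal_ne_top h)
    · intro h
      have := ENNReal.summable_toReal (lt_top_iff_ne_top.1 h)
      exact this.congr fun k => ENNReal.toReal_ofReal (hnn k)
  rw [this]
  exact measurableSet_lt (by fun_prop) measurable_const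

theorem ae_goodSet (δ : ℝ) (hδ : 0 < δ) : ∀ᵐ w ∂noise, w ∈ goodSet δ := by
  have h1 : ∀ k, ∫⁻ w, ENNReal.ofReal (lam k ^ (-(1 + δ)) * w k ^ 2) ∂noise
      = ENNReal.ofReal (lam k ^ (-(1 + δ))) := by
    intro k
    have hp := (Real.rpow_pos_of_pos (lam_pos k) (-(1 + δ))).le
    have hm := measurePreserving_eval_infinitePi (fun _ : ℤ × ℤ => gaussianReal 0 1) k
    simp_rw [ENNReal.ofReal_mul hp]
    rw [lintegral_const_mul _ (by fun_prop)]
    have : ∫⁻ w, ENNReal.ofReal (w k ^ 2) ∂noise = ∫⁻ x, ENNReal.ofReal (x ^ 2) ∂(gaussianReal 0 1) :=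
      hm.lintegral_comp (f := fun x : ℝ => ENNReal.ofReal (x ^ 2)) (by fun_prop)
    have hint : Integrable (fun x : ℝ => x ^ 2) (gaussianReal 0 1) :=
      (memLp_id_gaussianReal (μ := 0) (v := 1) 2).integrable_sq
    rw [this, ← ofReal_integral_eq_lintegral_ofReal hint
      (ae_of_all _ fun x => sq_nonneg x)]
    have hv := variance_id_gaussianReal (μ := 0) (v := 1)
    rw [variance_of_integral_eq_zero (by fun_prop) (by simp [integral_id_gaussianReal])] at hv
    simp only [id] at hv
    rw [hv]; simp
  have h2 : ∫⁻ w, ∑' k, ENNReal.ofReal (lam k ^ (-(1 + δ)) * w k ^ 2) ∂noise ≠ ⊤ := by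
    rw [lintegral_tsum (fun k => by
      have : Measurable fun w : ℤ × ℤ → ℝ => ENNReal.ofReal (lam k ^ (-(1 + δ)) * w k ^ 2) := by
        fun_prop
      exact this.aemeasurable)]
    simp_rw [h1]
    exact Summable.tsum_ofReal_ne_top (summable_lam_rpow (1 + δ) (by linarith))
  have h3 := ae_lt_top (Measurable.tsum fun k => by fun_prop) h2
  filter_upwards [h3] with w hw
  have := ENNReal.summable_toReal (lt_top_iff_ne_top.1 hw)
  exact this.congr fun k => ENNReal.toReal_ofReal
    (mul_nonneg (Real.rpow_pos_of_pos (lam_pos k) _).le (sq_nonneg _))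

open Classical in
def fieldCoeff (δ : ℝ) (w : ℤ × ℤ → ℝ) (k : ℤ × ℤ) : ℂ :=
  if w ∈ goodSet δ then rawCoeff w k else 0

theorem norm_rawCoeff_sq (w : ℤ × ℤ → ℝ) (k : ℤ × ℤ) :
    ‖rawCoeff w k‖ ^ 2 = lam k ^ (-1 : ℝ) * ((w k ^ 2 + w (-k) ^ 2) / 2) := by
  unfold rawCoeff
  have hl := lam_pos k
  rw [norm_mul, mul_pow, Complex.norm_real, Real.norm_of_nonneg (by positivity),
    ← Real.rpow_natCast (lam k ^ (-(1 / 2) : ℝ)), ← Real.rpow_mul hl.le, mul_comm Complex.I,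
    Complex.norm_add_mul_I, Real.sq_sqrt (by positivity)]
  norm_num
  left
  ring

theorem summable_fieldCoeff (δ : ℝ) (w : ℤ × ℤ → ℝ) :
    Summable fun k => lam k ^ (-δ) * ‖fieldCoeff δ w k‖ ^ 2 := by
  by_cases h : w ∈ goodSet δ
  · simp only [fieldCoeff, h, if_true]
    have h1 : Summable fun k => lam k ^ (-(1 + δ)) * w k ^ 2 := h
    have h2 : Summable fun k => lam (-k) ^ (-(1 + δ)) * w (-k) ^ 2 :=
      (Equiv.neg (ℤ × ℤ)).summable_iff.2 h1
    refine ((h1.add h2).div_const 2).congr fun k => ?_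
    rw [norm_rawCoeff_sq, lam_neg, show -(1 + δ) = -δ + -1 by ring, Real.rpow_add (lam_pos k)]
    ring
  · simp [fieldCoeff, h, summable_zero]

theorem real_fieldCoeff (δ : ℝ) (w : ℤ × ℤ → ℝ) (k : ℤ × ℤ) :
    fieldCoeff δ w (-k) = conj (fieldCoeff δ w k) := by
  unfold fieldCoeff
  split_ifs
  · simp only [rawCoeff, lam_neg, neg_neg, map_mul, map_add, Complex.conj_ofReal, Complex.conj_I]
    push_cast
    ring
  · simp

def field (δ : ℝ) (w : ℤ × ℤ → ℝ) : Sobolev (-δ) :=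
  ofCoeff (fieldCoeff δ w) (summable_fieldCoeff δ w) (real_fieldCoeff δ w)

theorem coeff_field (δ : ℝ) (w : ℤ × ℤ → ℝ) (k : ℤ × ℤ) :
    (field δ w).coeff k = fieldCoeff δ w k := coeff_ofCoeff _ _ _ k

theorem measurable_fieldCoeff (δ : ℝ) (k : ℤ × ℤ) : Measurable fun w => fieldCoeff δ w k := by
  unfold fieldCoeff
  refine Measurable.ite (measurableSet_goodSet δ) ?_ measurable_const
  unfold rawCoeff
  fun_prop

theorem measurable_field (δ : ℝ) : Measurable (field δ) := by
  let _ : MeasurableSpace (lp (fun _ : ℤ × ℤ => ℂ) 2) := borel _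
  have _ : BorelSpace (lp (fun _ : ℤ × ℤ => ℂ) 2) := ⟨rfl⟩
  have hb : (inferInstance : MeasurableSpace (Sobolev (-δ))) =
      (borel (lp (fun _ : ℤ × ℤ => ℂ) 2)).comap toL2 := borel_comap
  rw [measurable_iff_comap_le]
  change MeasurableSpace.comap (field δ) (inferInstance : MeasurableSpace (Sobolev (-δ))) ≤ _
  rw [hb, MeasurableSpace.comap_comp, ← measurable_iff_comap_le]
  refine measurable_of_tendsto_metrizable' (u := (atTop : Filter (Finset (ℤ × ℤ))))
    (f := fun F w => ∑ k ∈ F, lp.single (E := fun _ : ℤ × ℤ => ℂ) 2 k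
      (((lam k ^ (-δ / 2) : ℝ) : ℂ) * fieldCoeff δ w k)) ?_ ?_
  · intro F
    have hc : Continuous (fun c : ℤ × ℤ → ℂ =>
        ∑ k ∈ F, lp.single (E := fun _ : ℤ × ℤ => ℂ) 2 k (c k)) :=
      continuous_finsetSum F fun k _ =>
        (lp.isometry_single (E := fun _ : ℤ × ℤ => ℂ) (p := 2) k).continuous.comp
          (continuous_apply k)
    exact hc.measurable.comp (measurable_pi_lambda _ fun k =>
      (measurable_fieldCoeff δ k).const_mul _)
  · rw [tendsto_pi_nhds]
    intro w
    have := lp.hasSum_single (p := 2) (by norm_num) (toL2 (field δ w))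
    refine this.congr fun F => ?_
    refine Finset.sum_congr rfl fun k _ => ?_
    change lp.single (E := fun _ : ℤ × ℤ => ℂ) 2 k (((lam k ^ (-δ / 2) : ℝ) : ℂ) * (field δ w).coeff k) = _
    rw [coeff_field]

theorem hasSum_half {f : ℤ × ℤ → ℝ} {a : ℝ} (h : HasSum f a) :
    HasSum (fun k => (f k + f (-k)) / 2) a := by
  have h2 : HasSum (fun k => f (-k)) a := (Equiv.neg (ℤ × ℤ)).hasSum_iff.2 h
  simpa using (h.add h2).div_const 2

/-- The coefficients of `(l, ·)_E` with respect to the white noise. -/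
def linCoeff {δ : ℝ} (l : Sobolev (-δ)) (k : ℤ × ℤ) : ℝ :=
  lam k ^ (-δ - 1 / 2) * ((l.coeff k).re + (l.coeff k).im)

theorem add_sq_le_norm (z : ℂ) : (z.re + z.im) ^ 2 ≤ 2 * ‖z‖ ^ 2 := by
  rw [← Complex.normSq_eq_norm_sq, Complex.normSq_apply]
  nlinarith [sq_nonneg (z.re - z.im)]

theorem summable_linCoeff_sq {δ : ℝ} (hδ : 0 < δ) (l : Sobolev (-δ)) :
    Summable fun k => linCoeff l k ^ 2 := by
  refine Summable.of_nonneg_of_le (fun k => sq_nonneg _) (fun k => ?_) (l.summable.mul_left 2)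
  have hl := lam_pos k
  unfold linCoeff
  rw [mul_pow, ← Real.rpow_natCast, ← Real.rpow_mul hl.le]
  have h1 : lam k ^ ((-δ - 1 / 2) * ((2 : ℕ) : ℝ)) ≤ lam k ^ (-δ) :=
    Real.rpow_le_rpow_of_exponent_le (lam_one_le k) (by push_cast; linarith)
  have h2 := add_sq_le_norm (l.coeff k)
  calc _ ≤ lam k ^ (-δ) * (2 * ‖l.coeff k‖ ^ 2) := by gcongr
    _ = _ := by unfold coeff; ring

theorem summable_linCoeff_mul {δ : ℝ} (l : Sobolev (-δ)) {w : ℤ × ℤ → ℝ}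
    (h : w ∈ goodSet δ) : Summable fun k => linCoeff l k * w k := by
  have h1 : Summable fun k => lam k ^ (-(1 + δ)) * w k ^ 2 := h
  refine Summable.of_norm_bounded (h1.add (l.summable.mul_left 2)) fun k => ?_
  have hl := lam_pos k
  have h2 := add_sq_le_norm (l.coeff k)
  have e1 : lam k ^ (-δ - 1 / 2) = lam k ^ (-(1 + δ) / 2) * lam k ^ (-δ / 2) := by
    rw [← Real.rpow_add hl]; congr 1; ring
  have e2 : lam k ^ (-(1 + δ)) = (lam k ^ (-(1 + δ) / 2)) ^ 2 := by
    rw [← Real.rpow_natCast, ← Real.rpow_mul hl.le]; congr 1; push_cast; ring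
  have e3 : lam k ^ (-δ) = (lam k ^ (-δ / 2)) ^ 2 := by
    rw [← Real.rpow_natCast, ← Real.rpow_mul hl.le]; congr 1; push_cast; ring
  unfold linCoeff
  rw [e1, e2, e3, Real.norm_eq_abs]
  set p := lam k ^ (-(1 + δ) / 2)
  set q := lam k ^ (-δ / 2)
  change |p * q * ((l.coeff k).re + (l.coeff k).im) * w k| ≤
    p ^ 2 * w k ^ 2 + 2 * (q ^ 2 * ‖l.coeff k‖ ^ 2)
  have h3 : (q * ((l.coeff k).re + (l.coeff k).im)) ^ 2 ≤ 2 * (q ^ 2 * ‖l.coeff k‖ ^ 2) := by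
    rw [mul_pow]; nlinarith [sq_nonneg q]
  have h4 : |p * q * ((l.coeff k).re + (l.coeff k).im) * w k|
      = |p * w k| * |q * ((l.coeff k).re + (l.coeff k).im)| := by
    rw [← abs_mul]; congr 1; ring
  rw [h4]
  have := two_mul_le_add_sq |p * w k| |q * ((l.coeff k).re + (l.coeff k).im)|
  rw [sq_abs, sq_abs, mul_pow] at this
  nlinarith [abs_nonneg (p * w k), abs_nonneg (q * ((l.coeff k).re + (l.coeff k).im)),
    mul_nonneg (abs_nonneg (p * w k)) (abs_nonneg (q * ((l.coeff k).re + (l.coeff k).im)))]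

theorem re_tsum_eq {f : ℤ × ℤ → ℂ} {g : ℤ × ℤ → ℝ} {a : ℝ}
    (hg : HasSum g a) (hfg : ∀ k, (f k).re = (g k + g (-k)) / 2) (hf : Summable f) :
    (∑' k, f k).re = a := by
  rw [Complex.re_tsum hf]
  simp_rw [hfg]
  exact (hasSum_half hg).tsum_eq

theorem coeff_neg {s : ℝ} (u : Sobolev s) (k : ℤ × ℤ) : u.coeff (-k) = conj (u.coeff k) := u.real k

theorem innerProd_summable {s : ℝ} (u v : Sobolev s) :
    Summable fun k : ℤ × ℤ => ((lam k ^ s : ℝ) : ℂ) * (u.coeff k * v.coeff (-k)) := by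
  refine Summable.of_norm_bounded (u.summable.add v.summable) fun k => ?_
  have hl := (Real.rpow_pos_of_pos (lam_pos k) s)
  rw [norm_mul, norm_mul, coeff_neg, RCLike.norm_conj, Complex.norm_real,
    Real.norm_of_nonneg hl.le, ← mul_add]
  gcongr
  change _ ≤ ‖u.coeff k‖ ^ 2 + ‖v.coeff k‖ ^ 2
  nlinarith [sq_nonneg (‖u.coeff k‖ - ‖v.coeff k‖), sq_nonneg ‖u.coeff k‖, sq_nonneg ‖v.coeff k‖]

theorem innerProd_field {δ : ℝ} (l : Sobolev (-δ)) {w : ℤ × ℤ → ℝ} (h : w ∈ goodSet δ) :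
    HasSum (fun k => linCoeff l k * w k) (innerProd l (field δ w)) := by
  have hs := (summable_linCoeff_mul l h).hasSum
  convert hs using 1
  unfold innerProd
  refine re_tsum_eq (g := fun k => linCoeff l k * w k) hs ?_ (innerProd_summable _ _)
  · intro k
    have e1 : lam k ^ (-δ - 1 / 2) = lam k ^ (-δ) * lam k ^ (-(1 / 2) : ℝ) := by
      rw [← Real.rpow_add (lam_pos k)]; congr 1
    simp only [coeff_field, fieldCoeff, h, if_true, rawCoeff, linCoeff, lam_neg, coeff_neg,
      e1, Complex.conj_re, Complex.conj_im, Complex.mul_re, Complex.mul_im, Complex.add_re,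
      Complex.add_im, Complex.ofReal_re, Complex.ofReal_im, Complex.I_re, Complex.I_im]
    ring

theorem innerApow_eq {δ : ℝ} (hδ : 0 < δ) (l : Sobolev (-δ)) :
    HasSum (fun k => linCoeff l k ^ 2) (innerApow (1 + δ) l l) := by
  have hs := (summable_linCoeff_sq hδ l).hasSum
  convert hs using 1
  unfold innerApow
  refine re_tsum_eq (g := fun k => linCoeff l k ^ 2) hs ?_ ?_
  · intro k
    have hl := lam_pos k
    have e1 : lam k ^ (-δ) * (lam k)⁻¹ ^ (1 + δ) = (lam k ^ (-δ - 1 / 2)) ^ 2 := by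
      rw [Real.inv_rpow hl.le, ← Real.rpow_neg hl.le, ← Real.rpow_add hl,
        ← Real.rpow_natCast, ← Real.rpow_mul hl.le]
      congr 1; push_cast; ring
    simp only [linCoeff, lam_neg, coeff_neg, mul_pow, ← e1,
      Complex.conj_re, Complex.conj_im, Complex.mul_re, Complex.mul_im,
      Complex.ofReal_re, Complex.ofReal_im]
    ring
  · refine Summable.of_norm_bounded l.summable fun k => ?_
    have hl := lam_pos k
    rw [norm_mul, norm_mul, norm_mul, coeff_neg, RCLike.norm_conj, Complex.norm_real,
      Complex.norm_real, Real.norm_of_nonneg (by positivity), Real.norm_of_nonneg (by positivity)]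
    gcongr
    change _ ≤ ‖l.coeff k‖ ^ 2
    have : (lam k)⁻¹ ^ (1 + δ) ≤ 1 :=
      Real.rpow_le_one (by positivity) (inv_le_one_of_one_le₀ (lam_one_le k)) (by linarith)
    rw [mul_assoc, ← sq]
    exact mul_le_of_le_one_left (sq_nonneg _) this

theorem map_finset_sum (c : ℤ × ℤ → ℝ) (F : Finset (ℤ × ℤ)) :
    noise.map (fun w => ∑ k ∈ F, c k * w k) = gaussianReal 0 (∑ k ∈ F, c k ^ 2).toNNReal := by
  have hi : iIndepFun (fun k (w : ℤ × ℤ → ℝ) => c k * w k) noise :=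
    iIndepFun_infinitePi (P := fun _ : ℤ × ℤ => gaussianReal 0 1)
      (X := fun k (x : ℝ) => c k * x) (fun k => by fun_prop)
  induction F using Finset.induction_on with
  | empty => simp [gaussianReal_zero_var, Measure.map_const]
  | insert a F ha ih =>
    have h1 : noise.map (fun w => c a * w a) = gaussianReal 0 (c a ^ 2).toNNReal := by
      have hm := (measurePreserving_eval_infinitePi (fun _ : ℤ × ℤ => gaussianReal 0 1) a).map_eq
      have : (fun w : ℤ × ℤ → ℝ => c a * w a) = (fun x => c a * x) ∘ Function.eval a := rfl
      rw [this, ← Measure.map_map (by fun_prop) (by fun_prop)]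
      unfold noise
      rw [hm, gaussianReal_map_const_mul]
      congr 1
      · simp
      · ext; simp [Real.coe_toNNReal _ (sq_nonneg (c a))]
    have hind : IndepFun (fun w : ℤ × ℤ → ℝ => c a * w a)
        (fun w => ∑ k ∈ F, c k * w k) noise := by
      have := (hi.indepFun_finsetSum_of_notMem (fun k => by fun_prop) ha).symm
      convert this using 1
      ext w; simp
    have := gaussianReal_add_gaussianReal_of_indepFun hind h1 ih
    have e : (fun w : ℤ × ℤ → ℝ => ∑ k ∈ insert a F, c k * w k)
        = (fun w => c a * w a) + fun w => ∑ k ∈ F, c k * w k := by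
      ext w; simp [Finset.sum_insert ha]
    rw [e, this, Finset.sum_insert ha, Real.toNNReal_add (sq_nonneg _)
      (Finset.sum_nonneg fun k _ => sq_nonneg _), add_zero]

theorem continuous_innerProd {s : ℝ} (l : Sobolev s) : Continuous fun z => innerProd l z := by
  have h1 : Continuous (toL2 : Sobolev s → lp (fun _ : ℤ × ℤ => ℂ) 2) := continuous_induced_dom
  have h2 : (fun z : Sobolev s => innerProd l z) =
      fun z => (inner ℂ (toL2 z) (toL2 l) : ℂ).re := by
    ext z
    rw [lp.inner_eq_tsum]
    unfold innerProd
    congr 2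
    ext k
    change _ = (((lam k ^ (s / 2) : ℝ) : ℂ) * l.coeff k) *
      conj (((lam k ^ (s / 2) : ℝ) : ℂ) * z.coeff k)
    have : lam k ^ s = lam k ^ (s / 2) * lam k ^ (s / 2) := by
      rw [← Real.rpow_add (lam_pos k)]; congr 1; ring
    rw [this, coeff_neg, map_mul, Complex.conj_ofReal]
    push_cast
    ring
  rw [h2]
  fun_prop

/-- The Gaussian measure `N(0, A^{1+δ})` on `H^{-δ}` exists. -/
theorem exists_isFreeField (δ : ℝ) (hδ : 0 < δ) :
    ∃ μ : Measure (Sobolev (-δ)), IsFreeField δ μ := by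
  have hf := measurable_field δ
  refine ⟨noise.map (field δ), Measure.isProbabilityMeasure_map hf.aemeasurable, fun l => ?_⟩
  have hm : Measurable fun z => innerProd l z := (continuous_innerProd l).measurable
  rw [Measure.map_map hm hf]
  have hX : Measurable ((fun z => innerProd l z) ∘ field δ) := hm.comp hf
  have : IsProbabilityMeasure (noise.map ((fun z => innerProd l z) ∘ field δ)) :=
    Measure.isProbabilityMeasure_map hX.aemeasurable
  apply Measure.ext_of_charFun
  ext t
  have hV := innerApow_eq hδ l
  have hV0 : 0 ≤ innerApow (1 + δ) l l := hV.nonneg fun k => sq_nonneg _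
  rw [charFun_apply_real, integral_map hX.aemeasurable (by fun_prop)]
  have h1 : Tendsto (fun F : Finset (ℤ × ℤ) => ∫ w, Complex.exp
      (t * ((∑ k ∈ F, linCoeff l k * w k : ℝ) : ℂ) * Complex.I) ∂noise) atTop
      (𝓝 (∫ w, Complex.exp (t * (((fun z => innerProd l z) ∘ field δ) w : ℂ) * Complex.I)
        ∂noise)) := by
    refine tendsto_integral_filter_of_dominated_convergence (fun _ => (1 : ℝ)) ?_ ?_ ?_ ?_
    · exact Eventually.of_forall fun F => by
        refine Measurable.aestronglyMeasurable ?_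
        fun_prop
    · refine Eventually.of_forall fun F => ae_of_all _ fun w => ?_
      rw [← Complex.ofReal_mul, Complex.norm_exp_ofReal_mul_I]
    · exact integrable_const _
    · filter_upwards [ae_goodSet δ hδ] with w hw
      have h2 : Tendsto (fun F : Finset (ℤ × ℤ) => ∑ k ∈ F, linCoeff l k * w k) atTop
          (𝓝 (innerProd l (field δ w))) := innerProd_field l hw
      have hc : Continuous fun x : ℝ => Complex.exp (t * (x : ℂ) * Complex.I) := by fun_prop
      exact (hc.tendsto _).comp h2
  have h2 : ∀ F : Finset (ℤ × ℤ), ∫ w, Complex.exp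
      (t * ((∑ k ∈ F, linCoeff l k * w k : ℝ) : ℂ) * Complex.I) ∂noise
      = Complex.exp (-((∑ k ∈ F, linCoeff l k ^ 2 : ℝ) : ℂ) * t ^ 2 / 2) := by
    intro F
    have h3 := congrArg (fun μ => charFun μ t) (map_finset_sum (linCoeff l) F)
    beta_reduce at h3
    have hmF : Measurable fun w : ℤ × ℤ → ℝ => ∑ k ∈ F, linCoeff l k * w k := by fun_prop
    rw [charFun_apply_real, integral_map hmF.aemeasurable (by fun_prop), charFun_gaussianReal] at h3
    rw [h3]
    congr 1
    rw [Real.coe_toNNReal _ (Finset.sum_nonneg fun k _ => sq_nonneg _)]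
    simp
    ring
  simp_rw [h2] at h1
  have h4 : Tendsto (fun F : Finset (ℤ × ℤ) =>
      Complex.exp (-((∑ k ∈ F, linCoeff l k ^ 2 : ℝ) : ℂ) * t ^ 2 / 2)) atTop
      (𝓝 (Complex.exp (-((innerApow (1 + δ) l l : ℝ) : ℂ) * t ^ 2 / 2))) := by
    have h5 : Tendsto (fun F : Finset (ℤ × ℤ) => ∑ k ∈ F, linCoeff l k ^ 2) atTop
      (𝓝 (innerApow (1 + δ) l l)) := hV
    have hc : Continuous fun x : ℝ => Complex.exp (-(x : ℂ) * t ^ 2 / 2) := by fun_prop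
    exact (hc.tendsto _).comp h5
  rw [tendsto_nhds_unique h1 h4, charFun_gaussianReal]
  congr 1
  rw [Real.coe_toNNReal _ hV0]
  simp
  ring

/-- The space-time free field `μ₀ = N(0, A^{1+δ})` on `E = H^{-δ}`. -/
def freeField (δ : ℝ) (hδ : 0 < δ) : Measure (Sobolev (-δ)) :=
  (exists_isFreeField δ hδ).choose

theorem isFreeField_freeField (δ : ℝ) (hδ : 0 < δ) : IsFreeField δ (freeField δ hδ) :=
  (exists_isFreeField δ hδ).choose_spec

/-- The admissible cut-off sets: compact, symmetric, with the origin in the interior. -/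
def IsCutoff (Λ : Set (ℝ × ℝ)) : Prop :=
  IsCompact Λ ∧ -Λ = Λ ∧ (0 : ℝ × ℝ) ∈ interior Λ

/-- `∑_k 1_Λ(k) ẑ(k) 𝐞_k(x)`, as a complex number. -/
def projSum {s : ℝ} (Λ : Set (ℝ × ℝ)) (z : Sobolev s) (x : Torus) : ℂ :=
  ∑' k : ℤ × ℤ, Λ.indicator (fun _ => (1 : ℂ)) ((k.1 : ℝ), (k.2 : ℝ)) * z.coeff k * e k x

/-- The Fourier projection `(Π_Λ z)(x)`, a real number for symmetric `Λ`
(see `projSum_eq_proj`). -/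
def proj {s : ℝ} (Λ : Set (ℝ × ℝ)) (z : Sobolev s) (x : Torus) : ℝ := (projSum Λ z x).re

theorem projSum_eq_proj {s : ℝ} (Λ : Set (ℝ × ℝ)) (hΛ : -Λ = Λ) (z : Sobolev s) (x : Torus) :
    projSum Λ z x = (proj Λ z x : ℂ) := by
  symm
  apply Complex.conj_eq_iff_re.1
  unfold projSum
  rw [Complex.conj_tsum, ← (Equiv.neg (ℤ × ℤ)).tsum_eq]
  congr 1
  ext k
  have h1 : conj (Λ.indicator (fun _ => (1 : ℂ)) (((-k).1 : ℝ), ((-k).2 : ℝ)))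
      = Λ.indicator (fun _ => (1 : ℂ)) ((k.1 : ℝ), (k.2 : ℝ)) := by
    have : ((((-k).1 : ℤ) : ℝ), (((-k).2 : ℤ) : ℝ)) ∈ Λ ↔ ((k.1 : ℝ), (k.2 : ℝ)) ∈ Λ := by
      conv_rhs => rw [← hΛ]
      simp
    by_cases h : ((k.1 : ℝ), (k.2 : ℝ)) ∈ Λ
    · rw [Set.indicator_of_mem h, Set.indicator_of_mem (this.2 h), map_one]
    · rw [Set.indicator_of_notMem h, Set.indicator_of_notMem (fun h' => h (this.1 h')), map_zero]
  have h2 : conj (e (-k) x) = e k x := by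
    unfold e
    simp [map_ofNat]
  simp only [Equiv.neg_apply, map_mul, h1, h2, coeff_neg, Complex.conj_conj]

/-- `E^{μ₀}[(Π_Λ z)(x)²]`. -/
def projVar (δ : ℝ) (hδ : 0 < δ) (Λ : Set (ℝ × ℝ)) (x : Torus) : ℝ :=
  ∫ z, proj Λ z x ^ 2 ∂(freeField δ hδ)

/-- `∫ cos(a (Π_Λ z)(x)) exp((a²/2) E[(Π_Λ z)(x)²]) g(x) dx`. -/
def cosCutoff (δ : ℝ) (hδ : 0 < δ) (a : ℝ) (g : Torus → ℝ) (Λ : Set (ℝ × ℝ))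
    (z : Sobolev (-δ)) : ℝ :=
  ∫ x : Torus, Real.cos (a * proj Λ z x) * Real.exp (a ^ 2 / 2 * projVar δ hδ Λ x) * g x

/-- `∫ sin(a (Π_Λ z)(x)) exp((a²/2) E[(Π_Λ z)(x)²]) g(x) dx`. -/
def sinCutoff (δ : ℝ) (hδ : 0 < δ) (a : ℝ) (g : Torus → ℝ) (Λ : Set (ℝ × ℝ))
    (z : Sobolev (-δ)) : ℝ :=
  ∫ x : Torus, Real.sin (a * proj Λ z x) * Real.exp (a ^ 2 / 2 * projVar δ hδ Λ x) * g x

/-- `W` is the limit in `L²(μ₀)` of `F (NΛ)` as `N → ∞`, for every admissible `Λ`. -/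
def IsCutoffLimit (δ : ℝ) (hδ : 0 < δ) (F : Set (ℝ × ℝ) → Sobolev (-δ) → ℝ)
    (W : Sobolev (-δ) → ℝ) : Prop :=
  MemLp W 2 (freeField δ hδ) ∧ ∀ Λ, IsCutoff Λ →
    Tendsto (fun N : ℕ => eLpNorm (fun z => F ((N : ℝ) • Λ) z - W z) 2 (freeField δ hδ))
      atTop (𝓝 0)

/-- `W` is a version of the Wick cosine `:cos(az):(g)`. -/
def IsWickCos (δ : ℝ) (hδ : 0 < δ) (a : ℝ) (g : Torus → ℝ) (W : Sobolev (-δ) → ℝ) : Prop :=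
  IsCutoffLimit δ hδ (cosCutoff δ hδ a g) W

/-- `W` is a version of the Wick sine `:sin(az):(g)`. -/
def IsWickSin (δ : ℝ) (hδ : 0 < δ) (a : ℝ) (g : Torus → ℝ) (W : Sobolev (-δ) → ℝ) : Prop :=
  IsCutoffLimit δ hδ (sinCutoff δ hδ a g) W

end

end WickTrig

namespace WickTrig

noncomputable section

open ProbabilityTheory Filter Topology
open scoped ENNReal NNReal Pointwise ComplexConjugate
open Sobolev

/-! The cut-off Wick functional is a martingale in the set of Fourier modes, and its increments are
sub-Gaussian with summable constants exactly when `a ^ 2 < 4 * π`. No chaos expansion or lower bound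
on the functional is used.

In a real orthonormal basis the free field is a sum of modes with independent standard Gaussian
coordinates, so everything takes place under the product measure `noise`. Freeze the modes in `F`
and add the modes in a disjoint set `S`. Averaging over the new modes damps the cosine by `exp
(-(a²/2) Var_S)`, which cancels the new part of the Wick factor: the conditional mean is the
functional of `F` (`integral_trigIntegral_eq_wickTrig`). As a function of the new modes, the
functional has as `k`-th partial derivative a factor `-a * lam k ^ (-1/2)` times a coefficient of
`sin (...) * ρ` in the orthonormal basis. Bessel's inequality bounds the squared gradient by `a²`
times the largest `(lam k)⁻¹` over `S` times `∫ ρ²` (`sum_trigGrad_sq_le`). The Maurey-Pisier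
rotation argument (`integral_exp_le_of_gradient`) turns this into a bound on the conditional
exponential moment.

Pass from the box of size `2 ^ j` to that of size `2 ^ (j + 1)`. There `(lam k)⁻¹ ≤ 4 ^ (-j)`, while
the variance is at most `j * log 2 / (2π)` plus a constant, so `ρ²` costs `exp (a² * j * log 2 /
(2π))`. The exponential moment thus grows by a factor at most `exp (K * q ^ j)` with `q = exp (a² *
log 2 / (2π)) / 4`, and `q < 1` is the condition `a ^ 2 < 4 * π`. The product of these factors
converges, so all exponential moments, of either sign, are bounded uniformly along the dyadic boxes
(`exists_integral_exp_wickTrig_le`).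

These moments bound the second moments, so the martingale converges in `L²` along all finite sets of
modes, which covers every admissible cut-off. Fatou's lemma carries the exponential bound to the
limit; positivity of the partition function is that of an integrable exponential. The sine is the
cosine with a phase shift of `-π/2`. -/

/-! ### Invariances of white noise: resampling and rotation. -/

/-- Cramér-Wold: the laws of the finite linear combinations determine the joint characteristic
functions, and these factor. This criterion makes resampling, rotation and the passage to the free
field a matter of computing sums of squares. -/
theorem map_eq_infinitePi_gaussianReal {Ω ι : Type*} [MeasurableSpace Ω] {μ : Measure Ω}
    [IsProbabilityMeasure μ] {ξ : ι → Ω → ℝ} (hm : ∀ k, Measurable (ξ k))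
    (h : ∀ (F : Finset ι) (t : ι → ℝ), μ.map (fun ω => ∑ k ∈ F, t k * ξ k ω) =
      gaussianReal 0 (∑ k ∈ F, t k ^ 2).toNNReal) :
    μ.map (fun ω k => ξ k ω) = Measure.infinitePi fun _ => gaussianReal 0 1 := by
  have hmarg : ∀ k, μ.map (ξ k) = gaussianReal 0 1 := by
    intro k
    have := h {k} (fun _ => 1)
    simpa using this
  have hind : iIndepFun ξ μ := by
    classical
    rw [iIndepFun_iff_finset]
    intro F
    rw [iIndepFun_iff_charFun_pi (X := F.restrict ξ) (fun i => (hm i).aemeasurable)]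
    intro t
    have hmF : Measurable fun ω => WithLp.toLp 2 (fun i : F => F.restrict ξ i ω) :=
      (MeasurableEquiv.toLp 2 _).measurable.comp (measurable_pi_lambda _ fun i => hm i)
    -- Extending `t` by zero gives a sequence to which the hypothesis applies; the joint
    -- characteristic function at `t` is then that of the linear combination at frequency 1.
    let t' : ι → ℝ := fun k => if hk : k ∈ F then t ⟨k, hk⟩ else 0
    have hms : Measurable fun ω => ∑ k ∈ F, t' k * ξ k ω := by fun_prop
    have h1 := congrArg (fun ν => charFun ν 1) (h F t')
    beta_reduce at h1
    rw [charFun_apply_real, integral_map hms.aemeasurable (by fun_prop), charFun_gaussianReal] at h1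
    rw [charFun_apply, integral_map hmF.aemeasurable (by fun_prop)]
    have h2 : ∀ ω, inner ℝ (WithLp.toLp 2 (fun i : F => F.restrict ξ i ω)) t
        = ∑ k ∈ F, t' k * ξ k ω := by
      intro ω
      rw [PiLp.inner_apply, ← Finset.sum_coe_sort F]
      refine Finset.sum_congr rfl fun i _ => ?_
      simp [t']
    simp_rw [h2]
    have h3 : ∀ i : F, charFun (μ.map (F.restrict ξ i)) (t i) = Complex.exp (-(t i : ℂ) ^ 2 / 2) := by
      intro i
      rw [show F.restrict ξ i = ξ i from rfl, hmarg, charFun_gaussianReal]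
      congr 1
      simp
      ring
    simp_rw [h3]
    rw [← Complex.exp_sum]
    simp only [Complex.ofReal_one, one_mul] at h1
    rw [h1, Real.coe_toNNReal _ (Finset.sum_nonneg fun k _ => sq_nonneg _),
      ← Finset.sum_coe_sort F]
    congr 1
    simp only [t', Finset.coe_mem, dite_true, Subtype.coe_eta]
    push_cast
    rw [← Finset.sum_div]
    simp
    ring
  have := (iIndepFun_iff_map_fun_eq_infinitePi_map hm).1 hind
  simpa only [hmarg] using this

theorem map_prod_finset_sum (c d : ℤ × ℤ → ℝ) (F : Finset (ℤ × ℤ)) :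
    (noise.prod noise).map (fun p => ∑ k ∈ F, (c k * p.1 k + d k * p.2 k)) =
      gaussianReal 0 (∑ k ∈ F, (c k ^ 2 + d k ^ 2)).toNNReal := by
  have hc : Measurable fun w : ℤ × ℤ → ℝ => ∑ k ∈ F, c k * w k := by fun_prop
  have hd : Measurable fun w : ℤ × ℤ → ℝ => ∑ k ∈ F, d k * w k := by fun_prop
  have hind : IndepFun (fun p : (ℤ × ℤ → ℝ) × (ℤ × ℤ → ℝ) => ∑ k ∈ F, c k * p.1 k)
      (fun p => ∑ k ∈ F, d k * p.2 k) (noise.prod noise) := indepFun_prod hc hd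
  have h1 : (noise.prod noise).map (fun p => ∑ k ∈ F, c k * p.1 k) =
      gaussianReal 0 (∑ k ∈ F, c k ^ 2).toNNReal := by
    rw [← map_finset_sum, ← (measurePreserving_fst (μ := noise) (ν := noise)).map_eq,
      Measure.map_map hc measurable_fst, measurePreserving_fst.map_eq]
    rfl
  have h2 : (noise.prod noise).map (fun p => ∑ k ∈ F, d k * p.2 k) =
      gaussianReal 0 (∑ k ∈ F, d k ^ 2).toNNReal := by
    rw [← map_finset_sum, ← (measurePreserving_snd (μ := noise) (ν := noise)).map_eq,
      Measure.map_map hd measurable_snd, measurePreserving_snd.map_eq]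
    rfl
  have := gaussianReal_add_gaussianReal_of_indepFun hind h1 h2
  rw [add_zero, ← Real.toNNReal_add (Finset.sum_nonneg fun k _ => sq_nonneg _)
      (Finset.sum_nonneg fun k _ => sq_nonneg _), ← Finset.sum_add_distrib] at this
  rw [← this]
  congr 1
  ext p
  simp [Finset.sum_add_distrib]

/-- The sequence with entries `p.2 k` for `k ∈ S` and `p.1 k` otherwise. -/
def merge (S : Finset (ℤ × ℤ)) (p : (ℤ × ℤ → ℝ) × (ℤ × ℤ → ℝ)) : ℤ × ℤ → ℝ :=
  fun k => if k ∈ S then p.2 k else p.1 k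

/-- Linear combinations of the merged sequence are combinations of the two independent copies with
disjointly supported coefficients, so the sum of squares is unchanged. This allows averaging over
the modes in `S` with the others frozen. -/
theorem measurePreserving_merge (S : Finset (ℤ × ℤ)) :
    MeasurePreserving (merge S) (noise.prod noise) noise := by
  have hm : ∀ k, Measurable fun p : (ℤ × ℤ → ℝ) × (ℤ × ℤ → ℝ) => merge S p k := by
    intro k
    unfold merge
    split_ifs <;> fun_prop
  refine ⟨measurable_pi_lambda _ hm, ?_⟩
  refine map_eq_infinitePi_gaussianReal hm fun F t => ?_
  convert map_prod_finset_sum (fun k => if k ∈ S then 0 else t k)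
    (fun k => if k ∈ S then t k else 0) F using 4
  · unfold merge
    split_ifs <;> simp
  · split_ifs <;> simp

/-- Rotation of a pair of sequences. -/
def rotate (θ : ℝ) (p : (ℤ × ℤ → ℝ) × (ℤ × ℤ → ℝ)) : (ℤ × ℤ → ℝ) × (ℤ × ℤ → ℝ) :=
  (fun k => Real.sin θ * p.1 k + Real.cos θ * p.2 k,
    fun k => Real.cos θ * p.1 k - Real.sin θ * p.2 k)

theorem measurable_rotate (θ : ℝ) : Measurable (rotate θ) := by
  unfold rotate; fun_prop

/-- An orthogonal transformation preserves the sum of squares of the coefficients. The two rotated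
copies are packed into one sequence so that independence between them is included. -/
theorem map_sumElim_rotate (θ : ℝ) : (noise.prod noise).map
    (fun p k => Sum.elim (rotate θ p).1 (rotate θ p).2 k) =
      Measure.infinitePi fun _ : (ℤ × ℤ) ⊕ (ℤ × ℤ) => gaussianReal 0 1 := by
  classical
  refine map_eq_infinitePi_gaussianReal ?_ fun F t => ?_
  · rintro (k | k)
    · simp only [Sum.elim_inl, rotate]; fun_prop
    · simp only [Sum.elim_inr, rotate]; fun_prop
  -- A combination over the disjoint sum is rewritten over the common index set `G`, with the
  -- coefficients of each copy extended by zero.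
  · set G := F.toLeft ∪ F.toRight
    let u : ℤ × ℤ → ℝ := fun k => if k ∈ F.toLeft then t (Sum.inl k) else 0
    let v : ℤ × ℤ → ℝ := fun k => if k ∈ F.toRight then t (Sum.inr k) else 0
    have key : ∀ f : (ℤ × ℤ) ⊕ (ℤ × ℤ) → ℝ, ∑ i ∈ F, f i =
        ∑ k ∈ G, ((if k ∈ F.toLeft then f (Sum.inl k) else 0) +
          (if k ∈ F.toRight then f (Sum.inr k) else 0)) := by
      intro f
      rw [Finset.sum_add_distrib, Finset.sum_ite_mem, Finset.sum_ite_mem,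
        Finset.union_inter_cancel_left, Finset.union_inter_cancel_right,
        Finset.sum_sum_eq_sum_toLeft_add_sum_toRight]
    have h := map_prod_finset_sum (fun k => Real.sin θ * u k + Real.cos θ * v k)
      (fun k => Real.cos θ * u k - Real.sin θ * v k) G
    convert h using 3
    · rw [key]
      refine Finset.sum_congr rfl fun k _ => ?_
      simp only [u, v, rotate, Sum.elim_inl, Sum.elim_inr]
      split_ifs <;> ring
    · rw [key]
      refine Finset.sum_congr rfl fun k _ => ?_
      have hsc := Real.sin_sq_add_cos_sq θ
      have h1 : (Real.sin θ * u k + Real.cos θ * v k) ^ 2 + (Real.cos θ * u k - Real.sin θ * v k) ^ 2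
          = u k ^ 2 + v k ^ 2 := by linear_combination (u k ^ 2 + v k ^ 2) * hsc
      rw [h1]
      simp only [u, v]
      split_ifs <;> simp

theorem measurePreserving_rotate (θ : ℝ) :
    MeasurePreserving (rotate θ) (noise.prod noise) (noise.prod noise) := by
  refine ⟨measurable_rotate θ, ?_⟩
  let pack : (ℤ × ℤ → ℝ) × (ℤ × ℤ → ℝ) → ((ℤ × ℤ) ⊕ (ℤ × ℤ) → ℝ) := fun p k => Sum.elim p.1 p.2 k
  let unpack : ((ℤ × ℤ) ⊕ (ℤ × ℤ) → ℝ) → (ℤ × ℤ → ℝ) × (ℤ × ℤ → ℝ) := fun q =>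
    (fun k => q (Sum.inl k), fun k => q (Sum.inr k))
  have hpack : Measurable pack := by
    refine measurable_pi_lambda _ ?_
    rintro (k | k)
    · simp only [pack, Sum.elim_inl]; fun_prop
    · simp only [pack, Sum.elim_inr]; fun_prop
  have hunpack : Measurable unpack := by fun_prop
  have hinj : ∀ ν : Measure ((ℤ × ℤ → ℝ) × (ℤ × ℤ → ℝ)), (ν.map pack).map unpack = ν := by
    intro ν
    rw [Measure.map_map hunpack hpack, show unpack ∘ pack = id from rfl, Measure.map_id]
  have h1 : ((noise.prod noise).map (rotate θ)).map pack = Measure.infinitePi fun _ => gaussianReal 0 1 := by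
    rw [Measure.map_map hpack (measurable_rotate θ)]
    exact map_sumElim_rotate θ
  have h2 : (noise.prod noise).map pack = Measure.infinitePi fun _ => gaussianReal 0 1 := by
    -- The rotation by angle 0 is the swap of the two copies, which preserves the product measure.
    rw [← map_sumElim_rotate 0]
    conv_lhs => rw [← (Measure.measurePreserving_swap (μ := noise) (ν := noise)).map_eq]
    rw [Measure.map_map hpack measurable_swap]
    congr 1
    ext p k
    simp [rotate, pack]
  rw [← hinj ((noise.prod noise).map (rotate θ)), h1, ← h2, hinj]

/-! ### Gaussian concentration by the Maurey-Pisier rotation argument. -/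

theorem integrable_exp_finset_sum (c : ℤ × ℤ → ℝ) (S : Finset (ℤ × ℤ)) :
    Integrable (fun w => Real.exp (∑ k ∈ S, c k * w k)) noise ∧
      ∫ w, Real.exp (∑ k ∈ S, c k * w k) ∂noise = Real.exp ((∑ k ∈ S, c k ^ 2) / 2) := by
  have h := mgf_gaussianReal (map_finset_sum c S) 1
  simp only [mgf, one_mul, zero_add, one_pow, mul_one,
    Real.coe_toNNReal _ (Finset.sum_nonneg fun k (_ : k ∈ S) => sq_nonneg (c k))] at h
  refine ⟨?_, h⟩
  -- A non-integrable function has integral 0 by convention, while the value found is a positive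
  -- exponential.
  by_contra hn
  rw [integral_undef hn] at h
  exact (Real.exp_pos _).ne h

/-- Jensen's inequality for the uniform probability `b⁻¹ dt` and the function `b * h`, from the
tangent line of `exp` at the mean. -/
theorem exp_intervalIntegral_le {h : ℝ → ℝ} (hh : Continuous h) {b : ℝ} (hb : 0 < b) :
    Real.exp (∫ t in (0)..b, h t) ≤ ∫ t in (0)..b, b⁻¹ * Real.exp (b * h t) := by
  set m := ∫ t in (0)..b, h t
  have h1 : ∫ t in (0)..b, b⁻¹ * (Real.exp m * (1 + b * h t - m)) = Real.exp m := by
    rw [intervalIntegral.integral_const_mul, intervalIntegral.integral_const_mul,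
      intervalIntegral.integral_sub (Continuous.intervalIntegrable (by fun_prop) _ _)
        (Continuous.intervalIntegrable (by fun_prop) _ _),
      intervalIntegral.integral_add (Continuous.intervalIntegrable (by fun_prop) _ _)
        (Continuous.intervalIntegrable (by fun_prop) _ _),
      intervalIntegral.integral_const_mul]
    simp only [intervalIntegral.integral_const, sub_zero, smul_eq_mul, mul_one]
    change b⁻¹ * (Real.exp m * (b + b * m - b * m)) = _
    field_simp
    ring
  rw [← h1]
  refine intervalIntegral.integral_mono_on hb.le (Continuous.intervalIntegrable (by fun_prop) _ _)
    (Continuous.intervalIntegrable (by fun_prop) _ _) fun t _ => ?_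
  gcongr
  have := Real.add_one_le_exp (b * h t - m)
  calc Real.exp m * (1 + b * h t - m) ≤ Real.exp m * Real.exp (b * h t - m) := by
        gcongr; linarith
    _ = Real.exp (b * h t) := by rw [← Real.exp_add]; congr 1; ring

theorem exp_integral_le {Ω : Type*} [MeasurableSpace Ω] {μ : Measure Ω} [IsProbabilityMeasure μ]
    {f : Ω → ℝ} (hf : Integrable f μ) (he : Integrable (fun ω => Real.exp (f ω)) μ) :
    Real.exp (∫ ω, f ω ∂μ) ≤ ∫ ω, Real.exp (f ω) ∂μ := by
  set m := ∫ ω, f ω ∂μ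
  have h1 : ∫ ω, Real.exp m * (1 + f ω - m) ∂μ = Real.exp m := by
    rw [integral_const_mul, integral_sub (by fun_prop) (by fun_prop),
      integral_add (by fun_prop) hf]
    simp [m]
  rw [← h1]
  refine integral_mono (by fun_prop) he fun ω => ?_
  have := Real.add_one_le_exp (f ω - m)
  calc Real.exp m * (1 + f ω - m) ≤ Real.exp m * Real.exp (f ω - m) := by
        gcongr; linarith
    _ = Real.exp (f ω) := by rw [← Real.exp_add]; congr 1; ring

theorem integrable_exp_noise {h : (ℤ × ℤ → ℝ) → ℝ} (hh : Continuous h) {B : ℝ}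
    (hB : ∀ w, |h w| ≤ B) : Integrable (fun w => Real.exp (h w)) noise := by
  have hm : AEStronglyMeasurable (fun w => Real.exp (h w)) noise :=
    (Real.continuous_exp.comp hh).measurable.aestronglyMeasurable
  refine Integrable.of_bound hm (Real.exp B) (ae_of_all _ fun w => ?_)
  rw [Real.norm_of_nonneg (Real.exp_pos _).le]
  exact Real.exp_le_exp.2 (abs_le.1 (hB w)).2

theorem integrable_noise {h : (ℤ × ℤ → ℝ) → ℝ} (hh : Continuous h) {B : ℝ}
    (hB : ∀ w, |h w| ≤ B) : Integrable h noise :=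
  Integrable.of_bound hh.measurable.aestronglyMeasurable B (ae_of_all _ hB)

/-- By rotation invariance the bound need only be proved for the unrotated pair. With the first copy
fixed, the exponent is a centred Gaussian of variance at most `(π/2)² * L`, which produces the
constant `π²/8`. -/
theorem lintegral_exp_rotate_le {S : Finset (ℤ × ℤ)} {g : ℤ × ℤ → (ℤ × ℤ → ℝ) → ℝ}
    (hg : ∀ k, Continuous (g k)) {L : ℝ} (hL : ∀ w, ∑ k ∈ S, g k w ^ 2 ≤ L) (t : ℝ) :
    ∫⁻ p, ENNReal.ofReal ((Real.pi / 2)⁻¹ * Real.exp (Real.pi / 2 *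
      ∑ k ∈ S, g k (rotate t p).1 * (rotate t p).2 k)) ∂(noise.prod noise) ≤
      ENNReal.ofReal ((Real.pi / 2)⁻¹ * Real.exp (Real.pi ^ 2 / 8 * L)) := by
  set b := Real.pi / 2 with hb_def
  have hb : 0 < b := by positivity
  let G : (ℤ × ℤ → ℝ) × (ℤ × ℤ → ℝ) → ℝ := fun p => ∑ k ∈ S, g k p.1 * p.2 k
  have hG : Continuous G := by fun_prop
  have hm : Measurable fun p => ENNReal.ofReal (b⁻¹ * Real.exp (b * G p)) := by
    have := hG.measurable
    fun_prop
  refine ((measurePreserving_rotate t).lintegral_comp hm).trans_le ?_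
  rw [lintegral_prod _ hm.aemeasurable]
  calc _ ≤ ∫⁻ _, ENNReal.ofReal (b⁻¹ * Real.exp (Real.pi ^ 2 / 8 * L)) ∂noise := by
        refine lintegral_mono fun w => ?_
        obtain ⟨hi, he⟩ := integrable_exp_finset_sum (fun k => b * g k w) S
        have e1 : ∀ w', b * G (w, w') = ∑ k ∈ S, b * g k w * w' k := by
          intro w'
          simp only [G, Finset.mul_sum, mul_assoc]
        simp_rw [e1]
        rw [← ofReal_integral_eq_lintegral_ofReal (hi.const_mul _)
          (ae_of_all _ fun t => by positivity), integral_const_mul, he]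
        apply ENNReal.ofReal_le_ofReal
        gcongr
        simp_rw [mul_pow, ← Finset.mul_sum]
        have := hL w
        rw [hb_def]
        nlinarith [sq_nonneg Real.pi]
    _ = _ := by simp

/-- Gaussian concentration: if `∑ (∂_k f)² ≤ L` then `f - E f` is sub-Gaussian. -/
theorem integral_exp_le_of_gradient {S : Finset (ℤ × ℤ)} {f : (ℤ × ℤ → ℝ) → ℝ}
    {g : ℤ × ℤ → (ℤ × ℤ → ℝ) → ℝ} (hf : Continuous f) (hg : ∀ k, Continuous (g k))
    (hd : ∀ p t, HasDerivAt (fun t => f (rotate t p).1)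
      (∑ k ∈ S, g k (rotate t p).1 * (rotate t p).2 k) t)
    {B : ℝ} (hB : ∀ w, |f w| ≤ B) {L : ℝ} (hL : ∀ w, ∑ k ∈ S, g k w ^ 2 ≤ L) :
    ∫ w, Real.exp (f w) ∂noise ≤
      Real.exp (∫ w, f w ∂noise) * Real.exp (Real.pi ^ 2 / 8 * L) := by
  set b := Real.pi / 2 with hb_def
  have hb : 0 < b := by positivity
  obtain ⟨G, hGdef⟩ : ∃ G : (ℤ × ℤ → ℝ) × (ℤ × ℤ → ℝ) → ℝ,
    ∀ p, ∑ k ∈ S, g k p.1 * p.2 k = G p := ⟨_, fun _ => rfl⟩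
  have hG : Continuous G := by
    rw [← funext hGdef]
    fun_prop
  simp_rw [hGdef] at hd
  have hrot : Continuous fun q : ((ℤ × ℤ → ℝ) × (ℤ × ℤ → ℝ)) × ℝ => rotate q.2 q.1 := by
    unfold rotate; fun_prop
  have hGq : Continuous fun q : ((ℤ × ℤ → ℝ) × (ℤ × ℤ → ℝ)) × ℝ => G (rotate q.2 q.1) :=
    hG.comp hrot
  have hGt : ∀ p, Continuous fun t => G (rotate t p) := by
    intro p
    have h : Continuous fun t : ℝ => rotate t p := by
      unfold rotate; fun_prop
    exact hG.comp h
  have hpath : ∀ p : (ℤ × ℤ → ℝ) × (ℤ × ℤ → ℝ), ENNReal.ofReal (Real.exp (f p.1 - f p.2)) ≤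
      ∫⁻ t in Set.Ioc 0 b, ENNReal.ofReal (b⁻¹ * Real.exp (b * G (rotate t p))) := by
    intro p
    -- The quarter turn moves the first component from `p.2` at angle 0 to `p.1` at angle `π/2`, and
    -- the derivative of the first component is the second one.
    have h1 : f p.1 - f p.2 = ∫ t in (0)..b, G (rotate t p) := by
      rw [intervalIntegral.integral_eq_sub_of_hasDerivAt (fun t _ => hd p t)
        ((hGt p).intervalIntegrable _ _)]
      simp [rotate, hb_def]
    have hc : Continuous fun t => b⁻¹ * Real.exp (b * G (rotate t p)) :=
      continuous_const.mul (Real.continuous_exp.comp (continuous_const.mul (hGt p)))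
    rw [h1, ← ofReal_integral_eq_lintegral_ofReal
      ((hc.intervalIntegrable 0 b).1) (ae_of_all _ fun t => by positivity),
      ← intervalIntegral.integral_of_le hb.le]
    exact ENNReal.ofReal_le_ofReal (exp_intervalIntegral_le (hGt p) hb)
  have hinner := lintegral_exp_rotate_le hg hL
  simp_rw [hGdef] at hinner
  have hi1 := integrable_exp_noise hf hB
  have hi2 := integrable_exp_noise (h := fun w => -f w) hf.neg (fun w => by rw [abs_neg]; exact hB w)
  -- Comparing with an independent copy removes the mean: integrate the path bound over the pair,
  -- exchange the integrals and apply the bound at each angle.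
  have hprod : (∫ w, Real.exp (f w) ∂noise) * ∫ w, Real.exp (-f w) ∂noise ≤
      Real.exp (Real.pi ^ 2 / 8 * L) := by
    rw [← integral_prod_mul (fun w => Real.exp (f w)) (fun w => Real.exp (-f w))]
    simp_rw [← Real.exp_add, ← sub_eq_add_neg]
    have hi : Integrable (fun p : (ℤ × ℤ → ℝ) × (ℤ × ℤ → ℝ) => Real.exp (f p.1 - f p.2))
        (noise.prod noise) := by
      simp_rw [sub_eq_add_neg, Real.exp_add]
      exact hi1.mul_prod hi2
    rw [← ENNReal.ofReal_le_ofReal_iff (Real.exp_pos _).le,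
      ofReal_integral_eq_lintegral_ofReal hi (ae_of_all _ fun t => by positivity)]
    have hm : Measurable fun q : ((ℤ × ℤ → ℝ) × (ℤ × ℤ → ℝ)) × ℝ =>
        ENNReal.ofReal (b⁻¹ * Real.exp (b * G (rotate q.2 q.1))) :=
      ENNReal.measurable_ofReal.comp (((hGq.measurable.const_mul b).exp).const_mul b⁻¹)
    calc _ ≤ ∫⁻ p, (∫⁻ t in Set.Ioc 0 b, ENNReal.ofReal (b⁻¹ * Real.exp (b * G (rotate t p))))
          ∂(noise.prod noise) := lintegral_mono hpath
      _ = ∫⁻ t in Set.Ioc 0 b, ∫⁻ p, ENNReal.ofReal (b⁻¹ * Real.exp (b * G (rotate t p)))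
          ∂(noise.prod noise) := lintegral_lintegral_swap hm.aemeasurable
      _ ≤ ∫⁻ t in Set.Ioc 0 b, ENNReal.ofReal (b⁻¹ * Real.exp (Real.pi ^ 2 / 8 * L)) :=
          lintegral_mono hinner
      _ = _ := by
          rw [lintegral_const, Measure.restrict_apply MeasurableSet.univ, Set.univ_inter,
            Real.volume_Ioc, sub_zero, ← ENNReal.ofReal_mul (by positivity)]
          congr 1
          field_simp
  have hfi : Integrable f noise := integrable_noise hf hB
  -- Jensen for `-f` bounds the second factor of the product below by `exp (-E f)`, which restores
  -- the mean.
  have hj := exp_integral_le hfi.neg hi2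
  have hj' : Real.exp (-∫ w, f w ∂noise) ≤ ∫ w, Real.exp (-f w) ∂noise := by
    rw [← integral_neg]; exact hj
  have h0 : 0 ≤ ∫ w, Real.exp (f w) ∂noise := integral_nonneg fun w => (Real.exp_pos _).le
  have h1 : (∫ w, Real.exp (f w) ∂noise) * Real.exp (-∫ w, f w ∂noise) ≤
      Real.exp (Real.pi ^ 2 / 8 * L) := (mul_le_mul_of_nonneg_left hj' h0).trans hprod
  rw [Real.exp_neg, ← div_eq_mul_inv, div_le_iff₀ (Real.exp_pos _)] at h1
  linarith

/-! ### The field in a real basis, and Bessel's inequality. -/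

/-- The real orthonormal basis `(2π)⁻¹ (cos (k·x) - sin (k·x))`. -/
def hartley (k : ℤ × ℤ) (x : Torus) : ℝ := (e k x).re - (e k x).im

/-- The coefficient of the `k`-th white noise variable in the field at `x`. -/
def modeFun (k : ℤ × ℤ) (x : Torus) : ℝ := lam k ^ (-(1 / 2) : ℝ) * hartley k x

def fieldSum (F : Finset (ℤ × ℤ)) (w : ℤ × ℤ → ℝ) (x : Torus) : ℝ := ∑ k ∈ F, modeFun k x * w k

/-- The variance of `fieldSum F w x` under `noise`; see `integral_fieldSum_sq`. -/
def fieldVar (F : Finset (ℤ × ℤ)) (x : Torus) : ℝ := ∑ k ∈ F, modeFun k x ^ 2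

/-- `∫ cos (u(x) + a X(x)) ρ(x) dx` for the field `X` with modes in `S`. -/
def trigIntegral (u ρ : Torus → ℝ) (a : ℝ) (S : Finset (ℤ × ℤ)) (w : ℤ × ℤ → ℝ) : ℝ :=
  ∫ x, Real.cos (u x + a * fieldSum S w x) * ρ x

@[fun_prop]
theorem continuous_hartley (k : ℤ × ℤ) : Continuous (hartley k) := by
  have := e_continuous k
  unfold hartley
  fun_prop

@[fun_prop]
theorem continuous_modeFun (k : ℤ × ℤ) : Continuous (modeFun k) := by
  unfold modeFun; fun_prop

@[fun_prop]
theorem continuous_fieldSum (F : Finset (ℤ × ℤ)) :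
    Continuous fun q : (ℤ × ℤ → ℝ) × Torus => fieldSum F q.1 q.2 := by
  unfold fieldSum; fun_prop

@[fun_prop]
theorem continuous_fieldSum_left (F : Finset (ℤ × ℤ)) (x : Torus) :
    Continuous fun w => fieldSum F w x := by
  unfold fieldSum; fun_prop

@[fun_prop]
theorem continuous_fieldSum_right (F : Finset (ℤ × ℤ)) (w : ℤ × ℤ → ℝ) :
    Continuous (fieldSum F w) := by
  unfold fieldSum; fun_prop

@[fun_prop]
theorem continuous_fieldVar (F : Finset (ℤ × ℤ)) : Continuous (fieldVar F) := by
  unfold fieldVar; fun_prop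

theorem integrable_torus {f : Torus → ℝ} (hf : Continuous f) : Integrable f :=
  hf.integrable_of_hasCompactSupport (HasCompactSupport.of_compactSpace _)

theorem volume_real_torus : (volume : Measure Torus).real Set.univ = 4 * Real.pi ^ 2 := by
  rw [measureReal_def, ← Set.univ_prod_univ, Measure.volume_eq_prod, Measure.prod_prod,
    AddCircle.measure_univ, ENNReal.toReal_mul, ENNReal.toReal_ofReal Real.two_pi_pos.le]
  ring

theorem conj_e (k : ℤ × ℤ) (x : Torus) : conj (e k x) = e (-k) x := by
  unfold e
  simp [map_ofNat]

/-- The product is the real part of `I * e k * e j + e k * conj (e j)`. The first term integrates to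
0 or `I`, hence contributes nothing; the second gives orthonormality. -/
theorem integral_hartley_mul (k j : ℤ × ℤ) :
    ∫ x, hartley k x * hartley j x = if k = j then 1 else 0 := by
  have hi : ∀ k j, Integrable fun x => e k x * e j x := fun k j =>
    fint_integrable k ⟨e j, e_smooth j⟩
  have h1 : ∀ x, hartley k x * hartley j x =
      (Complex.I * (e k x * e j x) + e k x * e (-j) x).re := by
    intro x
    rw [← conj_e]
    simp only [hartley, Complex.add_re, Complex.mul_re, Complex.mul_im, Complex.I_re, Complex.I_im,
      Complex.conj_re, Complex.conj_im]
    ring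
  simp_rw [h1]
  have h2 := integral_re (𝕜 := ℂ) (((hi k j).const_mul Complex.I).add (hi k (-j)))
  simp only [Pi.add_apply, RCLike.re_to_complex] at h2
  rw [h2, integral_add ((hi k j).const_mul Complex.I) (hi k (-j)), integral_const_mul]
  have h3 := fint_e k j
  have h4 := fint_e k (-j)
  unfold fint at h3 h4
  rw [h3, h4, neg_neg]
  split_ifs <;> simp

/-- Bessel's inequality. -/
theorem sum_integral_mul_hartley_sq_le (S : Finset (ℤ × ℤ)) {s : Torus → ℝ} (hs : Continuous s) :
    ∑ k ∈ S, (∫ x, s x * hartley k x) ^ 2 ≤ ∫ x, s x ^ 2 := by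
  set c : ℤ × ℤ → ℝ := fun k => ∫ x, s x * hartley k x
  -- Expand the squared distance from `s` to its projection on the span of the modes in `S`.
  have h0 : 0 ≤ ∫ x, (s x - ∑ k ∈ S, c k * hartley k x) ^ 2 := integral_nonneg fun x => sq_nonneg _
  have h1 : ∀ x, (s x - ∑ k ∈ S, c k * hartley k x) ^ 2 = s x ^ 2
      - 2 * (∑ k ∈ S, c k * (s x * hartley k x))
      + ∑ k ∈ S, ∑ j ∈ S, c k * c j * (hartley k x * hartley j x) := by
    intro x
    have e1 : (∑ k ∈ S, c k * hartley k x) ^ 2 =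
        ∑ k ∈ S, ∑ j ∈ S, c k * c j * (hartley k x * hartley j x) := by
      rw [sq, Finset.sum_mul_sum]
      exact Finset.sum_congr rfl fun k _ => Finset.sum_congr rfl fun j _ => by ring
    have e2 : ∑ k ∈ S, c k * (s x * hartley k x) = s x * ∑ k ∈ S, c k * hartley k x := by
      rw [Finset.mul_sum]
      exact Finset.sum_congr rfl fun k _ => by ring
    rw [← e1, e2]
    ring
  simp_rw [h1] at h0
  rw [integral_add (integrable_torus (by fun_prop)) (integrable_torus (by fun_prop)),
    integral_sub (integrable_torus (by fun_prop)) (integrable_torus (by fun_prop)),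
    integral_const_mul, integral_finsetSum _ fun k _ => integrable_torus (by fun_prop),
    integral_finsetSum _ fun k _ => integrable_torus (by fun_prop)] at h0
  have h4 : ∀ k, ∫ x, ∑ j ∈ S, c k * c j * (hartley k x * hartley j x) =
      ∑ j ∈ S, c k * c j * (if k = j then (1 : ℝ) else 0) := by
    intro k
    rw [integral_finsetSum _ fun j _ => integrable_torus (by fun_prop)]
    simp_rw [integral_const_mul, integral_hartley_mul]
  simp_rw [h4, integral_const_mul] at h0
  have h2 : ∑ k ∈ S, c k * ∫ x, s x * hartley k x = ∑ k ∈ S, c k ^ 2 :=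
    Finset.sum_congr rfl fun k _ => (sq (c k)).symm
  rw [h2] at h0
  have h3 : ∑ k ∈ S, ∑ j ∈ S, c k * c j * (if k = j then (1 : ℝ) else 0) = ∑ k ∈ S, c k ^ 2 := by
    refine Finset.sum_congr rfl fun k hk => ?_
    simp [hk, sq]
  rw [h3] at h0
  linarith

/-! ### Mean, gradient and exponential moments of trigonometric integrals. -/

theorem continuous_trigIntegral {u ρ : Torus → ℝ} (hu : Continuous u) (hρ : Continuous ρ) (a : ℝ)
    (S : Finset (ℤ × ℤ)) : Continuous (trigIntegral u ρ a S) := by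
  unfold trigIntegral
  refine continuous_of_dominated (bound := fun x => |ρ x|) ?_ ?_ (integrable_torus hρ.abs) ?_
  · intro w
    exact Continuous.aestronglyMeasurable (by fun_prop)
  · refine fun w => ae_of_all _ fun x => ?_
    rw [Real.norm_eq_abs, abs_mul]
    exact mul_le_of_le_one_left (abs_nonneg _) (Real.abs_cos_le_one _)
  · exact ae_of_all _ fun x => by fun_prop

theorem abs_trigIntegral_le {u ρ : Torus → ℝ} {M : ℝ} (hM : ∀ x, |ρ x| ≤ M) (a : ℝ)
    (S : Finset (ℤ × ℤ)) (w : ℤ × ℤ → ℝ) : |trigIntegral u ρ a S w| ≤ M * (4 * Real.pi ^ 2) := by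
  have := norm_integral_le_of_norm_le_const (μ := (volume : Measure Torus))
    (f := fun x => Real.cos (u x + a * fieldSum S w x) * ρ x) (C := M) (ae_of_all _ fun x => by
      rw [Real.norm_eq_abs, abs_mul]
      exact (mul_le_of_le_one_left (abs_nonneg _) (Real.abs_cos_le_one _)).trans (hM x))
  rwa [volume_real_torus] at this

/-- The real part of a Gaussian characteristic function. The damping factor is the one that Wick
renormalisation compensates. -/
theorem integral_cos_noise (v : ℝ) (c : ℤ × ℤ → ℝ) (S : Finset (ℤ × ℤ)) (a : ℝ) :
    ∫ w, Real.cos (v + a * ∑ k ∈ S, c k * w k) ∂noise =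
      Real.cos v * Real.exp (-(a ^ 2 / 2 * ∑ k ∈ S, c k ^ 2)) := by
  have hm : Measurable fun w : ℤ × ℤ → ℝ => ∑ k ∈ S, c k * w k := by fun_prop
  have h1 := congrArg (fun ν => charFun ν a) (map_finset_sum c S)
  beta_reduce at h1
  rw [charFun_apply_real, integral_map hm.aemeasurable (by fun_prop), charFun_gaussianReal,
    Real.coe_toNNReal _ (Finset.sum_nonneg fun k _ => sq_nonneg _)] at h1
  have h2 : ∀ w : ℤ × ℤ → ℝ, Real.cos (v + a * ∑ k ∈ S, c k * w k) =
      (Complex.exp (v * Complex.I) * Complex.exp (a * (∑ k ∈ S, c k * w k : ℝ) * Complex.I)).re := by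
    intro w
    rw [← Complex.exp_add, ← add_mul, ← Complex.ofReal_mul, ← Complex.ofReal_add,
      Complex.exp_ofReal_mul_I_re]
  have hi : Integrable (fun w : ℤ × ℤ → ℝ => Complex.exp (v * Complex.I) *
      Complex.exp (a * (∑ k ∈ S, c k * w k : ℝ) * Complex.I)) noise := by
    refine Integrable.of_bound (Measurable.aestronglyMeasurable (by fun_prop)) 1
      (ae_of_all _ fun w => ?_)
    rw [← Complex.exp_add, ← add_mul, ← Complex.ofReal_mul, ← Complex.ofReal_add,
      Complex.norm_exp_ofReal_mul_I]
  simp_rw [h2]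
  have h3 := integral_re (𝕜 := ℂ) hi
  simp only [RCLike.re_to_complex] at h3
  rw [h3, integral_const_mul, h1]
  have h4 : ((a : ℂ) * ((0 : ℝ) : ℂ) * Complex.I - ((∑ k ∈ S, c k ^ 2 : ℝ) : ℂ) * (a : ℂ) ^ 2 / 2)
      = ((-(a ^ 2 / 2 * ∑ k ∈ S, c k ^ 2) : ℝ) : ℂ) := by
    push_cast; ring
  rw [h4, ← Complex.ofReal_exp, Complex.re_mul_ofReal, Complex.exp_ofReal_mul_I_re]

theorem integral_trigIntegral {u ρ : Torus → ℝ} (hu : Continuous u) (hρ : Continuous ρ) (a : ℝ)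
    (S : Finset (ℤ × ℤ)) : ∫ w, trigIntegral u ρ a S w ∂noise =
      ∫ x, Real.cos (u x) * Real.exp (-(a ^ 2 / 2 * fieldVar S x)) * ρ x := by
  unfold trigIntegral
  have hc : Continuous fun q : (ℤ × ℤ → ℝ) × Torus =>
      Real.cos (u q.2 + a * fieldSum S q.1 q.2) * ρ q.2 := by fun_prop
  have hi : Integrable (fun q : (ℤ × ℤ → ℝ) × Torus =>
      Real.cos (u q.2 + a * fieldSum S q.1 q.2) * ρ q.2) (noise.prod volume) := by
    obtain ⟨M, hM⟩ := isCompact_univ.exists_bound_of_continuousOn hρ.continuousOn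
    refine Integrable.of_bound hc.measurable.aestronglyMeasurable M (ae_of_all _ fun q => ?_)
    rw [norm_mul]
    exact (mul_le_of_le_one_left (norm_nonneg _) (Real.abs_cos_le_one _)).trans
      (hM q.2 (Set.mem_univ _))
  rw [integral_integral_swap hi]
  congr 1
  ext x
  rw [integral_mul_const]
  congr 1
  exact integral_cos_noise (u x) (fun k => modeFun k x) S a

/-- The partial derivatives of `trigIntegral`. -/
def trigGrad (u ρ : Torus → ℝ) (a : ℝ) (S : Finset (ℤ × ℤ)) (k : ℤ × ℤ) (w : ℤ × ℤ → ℝ) : ℝ :=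
  ∫ x, -(a * lam k ^ (-(1 / 2) : ℝ)) * ((Real.sin (u x + a * fieldSum S w x) * ρ x) * hartley k x)

theorem continuous_trigGrad {u ρ : Torus → ℝ} (hu : Continuous u) (hρ : Continuous ρ) (a : ℝ)
    (S : Finset (ℤ × ℤ)) (k : ℤ × ℤ) : Continuous (trigGrad u ρ a S k) := by
  unfold trigGrad
  refine continuous_of_dominated
    (bound := fun x => |a * lam k ^ (-(1 / 2) : ℝ)| * (|ρ x| * |hartley k x|)) ?_ ?_
    (integrable_torus (by fun_prop)) ?_
  · intro w
    exact Continuous.aestronglyMeasurable (by fun_prop)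
  · refine fun w => ae_of_all _ fun x => ?_
    rw [norm_mul, norm_neg, norm_mul, norm_mul]
    simp only [Real.norm_eq_abs, abs_mul]
    gcongr
    exact mul_le_of_le_one_left (abs_nonneg _) (Real.abs_sin_le_one _)
  · exact ae_of_all _ fun x => by fun_prop

/-- Up to the factor `-a * lam k ^ (-1/2)`, the partial derivatives are the coefficients of one
function, `sin (...) * ρ`, in an orthonormal system. Bessel's inequality therefore bounds their
squares together, uniformly in `w` and in the number of modes. -/
theorem sum_trigGrad_sq_le {u ρ : Torus → ℝ} (hu : Continuous u) (hρ : Continuous ρ) (a : ℝ)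
    {S : Finset (ℤ × ℤ)} {M r : ℝ} (hM : ∀ x, |ρ x| ≤ M) (hr : ∀ k ∈ S, (lam k)⁻¹ ≤ r)
    (hr0 : 0 ≤ r) (w : ℤ × ℤ → ℝ) :
    ∑ k ∈ S, trigGrad u ρ a S k w ^ 2 ≤ a ^ 2 * r * (M ^ 2 * (4 * Real.pi ^ 2)) := by
  set s : Torus → ℝ := fun x => Real.sin (u x + a * fieldSum S w x) * ρ x
  have hs : Continuous s := by fun_prop
  have h1 : ∫ x, s x ^ 2 ≤ M ^ 2 * (4 * Real.pi ^ 2) := by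
    have h2 : ∀ x, s x ^ 2 ≤ M ^ 2 := by
      intro x
      rw [← sq_abs (s x)]
      gcongr
      rw [abs_mul]
      exact (mul_le_of_le_one_left (abs_nonneg _) (Real.abs_sin_le_one _)).trans (hM x)
    calc ∫ x, s x ^ 2 ≤ ∫ _ : Torus, M ^ 2 :=
          integral_mono (integrable_torus (by fun_prop)) (integrable_const _) h2
      _ = _ := by rw [integral_const, volume_real_torus, smul_eq_mul, mul_comm]
  calc ∑ k ∈ S, trigGrad u ρ a S k w ^ 2
      = ∑ k ∈ S, a ^ 2 * (lam k)⁻¹ * (∫ x, s x * hartley k x) ^ 2 := by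
        refine Finset.sum_congr rfl fun k _ => ?_
        unfold trigGrad
        have hl : (lam k ^ (-(1 / 2) : ℝ)) ^ 2 = (lam k)⁻¹ := by
          rw [← Real.rpow_natCast, ← Real.rpow_mul (lam_pos k).le, ← Real.rpow_neg_one]
          norm_num
        rw [integral_const_mul, mul_pow, neg_sq, mul_pow, hl]
    _ ≤ ∑ k ∈ S, a ^ 2 * r * (∫ x, s x * hartley k x) ^ 2 := by
        refine Finset.sum_le_sum fun k hk => ?_
        have := hr k hk
        gcongr
    _ = a ^ 2 * r * ∑ k ∈ S, (∫ x, s x * hartley k x) ^ 2 := by rw [Finset.mul_sum]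
    _ ≤ _ := by
        gcongr
        exact (sum_integral_mul_hartley_sq_le S hs).trans h1

/-- The chain rule along the rotation, differentiating under the integral; the dominating function
uses only `|sin|, |cos| ≤ 1` and so works for all `t` at once. -/
theorem hasDerivAt_trigIntegral_rotate {u ρ : Torus → ℝ} (hu : Continuous u) (hρ : Continuous ρ)
    (a : ℝ) (S : Finset (ℤ × ℤ)) (p : (ℤ × ℤ → ℝ) × (ℤ × ℤ → ℝ)) (t : ℝ) :
    HasDerivAt (fun t => trigIntegral u ρ a S (rotate t p).1)
      (∑ k ∈ S, trigGrad u ρ a S k (rotate t p).1 * (rotate t p).2 k) t := by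
  have hX : ∀ x t, HasDerivAt (fun t => fieldSum S (rotate t p).1 x)
      (fieldSum S (rotate t p).2 x) t := by
    intro x t
    unfold fieldSum rotate
    refine HasDerivAt.fun_sum fun k _ => ?_
    have := (((Real.hasDerivAt_sin t).mul_const (p.1 k)).add
      ((Real.hasDerivAt_cos t).mul_const (p.2 k))).const_mul (modeFun k x)
    exact this.congr_deriv (by ring)
  have hY : ∀ x t, |fieldSum S (rotate t p).2 x| ≤
      ∑ k ∈ S, |modeFun k x| * (|p.1 k| + |p.2 k|) := by
    intro x t
    refine (Finset.abs_sum_le_sum_abs _ _).trans (Finset.sum_le_sum fun k _ => ?_)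
    rw [abs_mul]
    gcongr
    refine (abs_sub _ _).trans ?_
    rw [abs_mul, abs_mul]
    gcongr
    · exact mul_le_of_le_one_left (abs_nonneg _) (Real.abs_cos_le_one _)
    · exact mul_le_of_le_one_left (abs_nonneg _) (Real.abs_sin_le_one _)
  have h := hasDerivAt_integral_of_dominated_loc_of_deriv_le (μ := (volume : Measure Torus))
    (F := fun t x => Real.cos (u x + a * fieldSum S (rotate t p).1 x) * ρ x)
    (F' := fun t x => -Real.sin (u x + a * fieldSum S (rotate t p).1 x) *
      (a * fieldSum S (rotate t p).2 x) * ρ x)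
    (bound := fun x => |a| * (∑ k ∈ S, |modeFun k x| * (|p.1 k| + |p.2 k|)) * |ρ x|)
    (x₀ := t) (s := Set.univ) Filter.univ_mem
    (Eventually.of_forall fun t => Continuous.aestronglyMeasurable (by fun_prop))
    (integrable_torus (by fun_prop)) (Continuous.aestronglyMeasurable (by fun_prop))
    (ae_of_all _ fun x t _ => by
      calc _ = |Real.sin (u x + a * fieldSum S (rotate t p).1 x)| *
            (|a| * |fieldSum S (rotate t p).2 x|) * |ρ x| := by
            rw [norm_mul, norm_mul, norm_neg, norm_mul]
            rfl
        _ ≤ 1 * (|a| * ∑ k ∈ S, |modeFun k x| * (|p.1 k| + |p.2 k|)) * |ρ x| := by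
            gcongr
            · exact Real.abs_sin_le_one _
            · exact hY x t
        _ = _ := by rw [one_mul])
    (integrable_torus (by fun_prop))
    (ae_of_all _ fun x t _ => (((hX x t).const_mul a).const_add (u x)).cos.mul_const (ρ x))
  refine h.2.congr_deriv ?_
  simp only [trigGrad]
  simp_rw [← integral_mul_const]
  rw [← integral_finsetSum _ fun k _ => integrable_torus (by fun_prop)]
  congr 1
  ext x
  simp only [fieldSum, Finset.mul_sum, Finset.sum_mul]
  refine Finset.sum_congr rfl fun k _ => ?_
  simp only [modeFun]
  ring

theorem integral_exp_trigIntegral_le {u ρ : Torus → ℝ} (hu : Continuous u) (hρ : Continuous ρ)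
    (a : ℝ) {S : Finset (ℤ × ℤ)} {M r : ℝ} (hM : ∀ x, |ρ x| ≤ M) (hr : ∀ k ∈ S, (lam k)⁻¹ ≤ r)
    (hr0 : 0 ≤ r) (l : ℝ) :
    ∫ w, Real.exp (l * trigIntegral u ρ a S w) ∂noise ≤
      Real.exp (l * ∫ w, trigIntegral u ρ a S w ∂noise) *
        Real.exp (Real.pi ^ 2 / 8 * (l ^ 2 * (a ^ 2 * r * (M ^ 2 * (4 * Real.pi ^ 2))))) := by
  rw [← integral_const_mul]
  refine integral_exp_le_of_gradient (S := S) (g := fun k w => l * trigGrad u ρ a S k w)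
    (continuous_const.mul (continuous_trigIntegral hu hρ a S))
    (fun k => continuous_const.mul (continuous_trigGrad hu hρ a S k)) (fun p t => ?_)
    -- This crude bound only secures integrability and does not enter the estimate.
    (B := |l| * (M * (4 * Real.pi ^ 2))) (fun w => ?_) (fun w => ?_)
  · refine ((hasDerivAt_trigIntegral_rotate hu hρ a S p t).const_mul l).congr_deriv ?_
    rw [Finset.mul_sum]
    exact Finset.sum_congr rfl fun k _ => by ring
  · change |l * trigIntegral u ρ a S w| ≤ _
    rw [abs_mul]
    gcongr
    exact abs_trigIntegral_le hM a S w
  · simp_rw [mul_pow, ← Finset.mul_sum]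
    gcongr
    exact sum_trigGrad_sq_le hu hρ a hM hr hr0 w

/-! ### Logarithmic growth of the variance over boxes. -/

/-- The mean value theorem for `arctan`, whose derivative decreases on the positive axis. These
differences telescope, and the limit `π/2` gives the sharp constant in the next lemma. -/
theorem inv_sq_add_sq_le_arctan_sub {A : ℝ} (hA : 0 < A) (n : ℕ) :
    (A ^ 2 + ((n : ℝ) + 1) ^ 2)⁻¹ ≤
      A⁻¹ * (Real.arctan (((n : ℝ) + 1) / A) - Real.arctan ((n : ℝ) / A)) := by
  have hlt : (n : ℝ) / A < ((n : ℝ) + 1) / A := by gcongr; linarith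
  obtain ⟨c, ⟨hc1, hc2⟩, hc⟩ := exists_hasDerivAt_eq_slope Real.arctan (fun x => 1 / (1 + x ^ 2)) hlt
    Real.continuous_arctan.continuousOn (fun x _ => Real.hasDerivAt_arctan x)
  have h1 : ((n : ℝ) + 1) / A - n / A = A⁻¹ := by field_simp; ring
  rw [h1, eq_div_iff (by positivity)] at hc
  rw [← hc]
  have hc0 : 0 ≤ c := (by positivity : (0 : ℝ) ≤ n / A).trans hc1.le
  have h2 : c ^ 2 ≤ (((n : ℝ) + 1) / A) ^ 2 := by gcongr
  have h3 : A⁻¹ * (1 / (1 + c ^ 2) * A⁻¹) = (A ^ 2 + A ^ 2 * c ^ 2)⁻¹ := by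
    field_simp
  rw [h3]
  gcongr
  rw [div_pow] at h2
  have := mul_le_mul_of_nonneg_left h2 (sq_nonneg A)
  rwa [mul_div_cancel₀ _ (by positivity)] at this

theorem sum_inv_sq_add_sq_le {A : ℝ} (hA : 0 < A) (n : ℕ) :
    ∑ m ∈ Finset.Icc (-(n : ℤ)) n, (A ^ 2 + (m : ℝ) ^ 2)⁻¹ ≤ (A ^ 2)⁻¹ + Real.pi * A⁻¹ := by
  have h1 : ∑ m ∈ Finset.Icc (-(n : ℤ)) n, (A ^ 2 + (m : ℝ) ^ 2)⁻¹ =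
      (A ^ 2)⁻¹ + 2 * ∑ m ∈ Finset.range n, (A ^ 2 + ((m : ℝ) + 1) ^ 2)⁻¹ := by
    rw [Finset.sum_Icc_of_even_eq_range (f := fun m : ℤ => (A ^ 2 + (m : ℝ) ^ 2)⁻¹)
      (fun m => by simp), Finset.sum_range_succ']
    simp
    ring
  have h2 : ∑ m ∈ Finset.range n, (A ^ 2 + ((m : ℝ) + 1) ^ 2)⁻¹ ≤ A⁻¹ * Real.arctan (n / A) := by
    calc _ ≤ ∑ m ∈ Finset.range n,
          A⁻¹ * (Real.arctan (((m : ℝ) + 1) / A) - Real.arctan ((m : ℝ) / A)) :=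
          Finset.sum_le_sum fun m _ => inv_sq_add_sq_le_arctan_sub hA m
      _ = _ := by
          rw [← Finset.mul_sum]
          congr 1
          have := Finset.sum_range_sub (fun m : ℕ => Real.arctan ((m : ℝ) / A)) n
          simpa using this
  have h3 := (Real.arctan_lt_pi_div_two (n / A)).le
  have h4 : A⁻¹ * Real.arctan (n / A) ≤ A⁻¹ * (Real.pi / 2) := by gcongr
  linarith

/-- The modes `k` with `|k|_∞ ≤ n`. -/
def box (n : ℕ) : Finset (ℤ × ℤ) := Finset.Icc (-(n : ℤ)) n ×ˢ Finset.Icc (-(n : ℤ)) n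

theorem mem_box {n : ℕ} {k : ℤ × ℤ} : k ∈ box n ↔ |k.1| ≤ n ∧ |k.2| ≤ n := by
  simp [box, Finset.mem_product, Finset.mem_Icc, abs_le]

theorem box_mono {m n : ℕ} (h : m ≤ n) : box m ⊆ box n := by
  intro k hk
  rw [mem_box] at hk ⊢
  omega

theorem exists_subset_box (F : Finset (ℤ × ℤ)) : ∃ j, F ⊆ box (2 ^ j) := by
  refine ⟨F.sup fun k => k.1.natAbs + k.2.natAbs, fun k hk => ?_⟩
  have h1 := Finset.le_sup (f := fun k : ℤ × ℤ => k.1.natAbs + k.2.natAbs) hk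
  generalize F.sup (fun k => k.1.natAbs + k.2.natAbs) = j at h1 ⊢
  have h2 : j < 2 ^ j := Nat.lt_two_pow_self
  generalize 2 ^ j = n at h2
  rw [mem_box, Int.abs_eq_natAbs, Int.abs_eq_natAbs]
  omega

theorem inv_lam_le_of_notMem_box {n : ℕ} (hn : 0 < n) {k : ℤ × ℤ} (hk : k ∉ box n) :
    (lam k)⁻¹ ≤ ((n : ℝ) ^ 2)⁻¹ := by
  have hn' : (0 : ℝ) < n := by exact_mod_cast hn
  rw [mem_box, not_and_or, not_le, not_le] at hk
  apply inv_anti₀ (by positivity)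
  unfold lam
  rcases hk with h | h
  · have h1 : (n : ℝ) < |(k.1 : ℝ)| := by exact_mod_cast h
    have : (n : ℝ) ^ 2 ≤ (k.1 : ℝ) ^ 2 := by rw [← sq_abs (k.1 : ℝ)]; gcongr
    nlinarith [sq_nonneg (k.2 : ℝ)]
  · have h1 : (n : ℝ) < |(k.2 : ℝ)| := by exact_mod_cast h
    have : (n : ℝ) ^ 2 ≤ (k.2 : ℝ) ^ 2 := by rw [← sq_abs (k.2 : ℝ)]; gcongr
    nlinarith [sq_nonneg (k.1 : ℝ)]

/-- The inner sum, compared with an arctangent, leaves `π / √(1 + i²)`; the outer sum is then twice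
a harmonic sum plus bounded terms. The leading constant `2 * π` matters, since it fixes the
threshold for `a`; the additive constant does not. -/
theorem sum_box_inv_lam_le (n : ℕ) :
    ∑ k ∈ box n, (lam k)⁻¹ ≤ 2 * Real.pi * Real.log n + (1 + 4 * Real.pi) := by
  have h1 : ∀ i : ℤ, ∑ m ∈ Finset.Icc (-(n : ℤ)) n, (lam (i, m))⁻¹ ≤
      (1 + (i : ℝ) ^ 2)⁻¹ + Real.pi * (Real.sqrt (1 + (i : ℝ) ^ 2))⁻¹ := by
    intro i
    have h := sum_inv_sq_add_sq_le (A := Real.sqrt (1 + (i : ℝ) ^ 2)) (by positivity) n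
    rw [Real.sq_sqrt (by positivity)] at h
    simpa only [lam, ← add_assoc] using h
  have h2 : ∑ i ∈ Finset.Icc (-(n : ℤ)) n, (1 + (i : ℝ) ^ 2)⁻¹ ≤ 1 + Real.pi := by
    simpa using sum_inv_sq_add_sq_le one_pos n
  have h3 : ∑ i ∈ Finset.Icc (-(n : ℤ)) n, (Real.sqrt (1 + (i : ℝ) ^ 2))⁻¹ ≤
      3 + 2 * Real.log n := by
    rw [Finset.sum_Icc_of_even_eq_range (f := fun m : ℤ => (Real.sqrt (1 + (m : ℝ) ^ 2))⁻¹)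
      (fun m => by simp), Finset.sum_range_succ']
    have h4 : ∑ m ∈ Finset.range n, (Real.sqrt (1 + (((m + 1 : ℕ) : ℤ) : ℝ) ^ 2))⁻¹ ≤
        (harmonic n : ℝ) := by
      unfold harmonic
      push_cast
      refine Finset.sum_le_sum fun m _ => ?_
      apply inv_anti₀ (by positivity)
      apply Real.le_sqrt_of_sq_le
      linarith
    have h5 := harmonic_le_one_add_log n
    simp only [two_nsmul, Nat.cast_zero, Int.cast_zero, ne_eq, OfNat.ofNat_ne_zero,
      not_false_eq_true, zero_pow, add_zero, Real.sqrt_one, inv_one]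
    linarith
  calc ∑ k ∈ box n, (lam k)⁻¹
      = ∑ i ∈ Finset.Icc (-(n : ℤ)) n, ∑ m ∈ Finset.Icc (-(n : ℤ)) n, (lam (i, m))⁻¹ := by
        rw [box, Finset.sum_product]
    _ ≤ ∑ i ∈ Finset.Icc (-(n : ℤ)) n,
        ((1 + (i : ℝ) ^ 2)⁻¹ + Real.pi * (Real.sqrt (1 + (i : ℝ) ^ 2))⁻¹) :=
        Finset.sum_le_sum fun i _ => h1 i
    _ = ∑ i ∈ Finset.Icc (-(n : ℤ)) n, (1 + (i : ℝ) ^ 2)⁻¹ +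
        Real.pi * ∑ i ∈ Finset.Icc (-(n : ℤ)) n, (Real.sqrt (1 + (i : ℝ) ^ 2))⁻¹ := by
        rw [Finset.sum_add_distrib, Finset.mul_sum]
    _ ≤ (1 + Real.pi) + Real.pi * (3 + 2 * Real.log n) := by gcongr
    _ = _ := by ring

theorem norm_e (k : ℤ × ℤ) (x : Torus) : ‖e k x‖ = (2 * Real.pi)⁻¹ := by
  unfold e
  rw [norm_mul, norm_mul, norm_fourier_one, norm_fourier_one]
  simp [abs_of_pos Real.pi_pos]

theorem modeFun_sq (k : ℤ × ℤ) (x : Torus) :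
    modeFun k x ^ 2 = (lam k)⁻¹ * hartley k x ^ 2 := by
  unfold modeFun
  rw [mul_pow, ← Real.rpow_natCast, ← Real.rpow_mul (lam_pos k).le, ← Real.rpow_neg_one]
  norm_num

/-- The box is symmetric, and the squares at `k` and `-k` add up to `2 * ‖e k x‖ ^ 2`, which does
not depend on `x`. -/
theorem fieldVar_box (n : ℕ) (x : Torus) :
    fieldVar (box n) x = (4 * Real.pi ^ 2)⁻¹ * ∑ k ∈ box n, (lam k)⁻¹ := by
  have h1 : ∀ k, modeFun k x ^ 2 + modeFun (-k) x ^ 2 = 2 * ((4 * Real.pi ^ 2)⁻¹ * (lam k)⁻¹) := by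
    intro k
    rw [modeFun_sq, modeFun_sq, lam_neg]
    have h2 : hartley k x ^ 2 + hartley (-k) x ^ 2 = 2 * ‖e k x‖ ^ 2 := by
      rw [← Complex.normSq_eq_norm_sq, Complex.normSq_apply]
      unfold hartley
      rw [← conj_e, Complex.conj_re, Complex.conj_im]
      ring
    rw [← mul_add, h2, norm_e]
    ring
  have h2 : ∑ k ∈ box n, modeFun (-k) x ^ 2 = ∑ k ∈ box n, modeFun k x ^ 2 :=
    Finset.sum_equiv (Equiv.neg (ℤ × ℤ)) (fun k => by simp [mem_box]) fun k _ => rfl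
  have h3 : ∑ k ∈ box n, (modeFun k x ^ 2 + modeFun (-k) x ^ 2) =
      2 * ((4 * Real.pi ^ 2)⁻¹ * ∑ k ∈ box n, (lam k)⁻¹) := by
    rw [Finset.mul_sum, Finset.mul_sum]
    exact Finset.sum_congr rfl fun k _ => h1 k
  rw [Finset.sum_add_distrib, h2] at h3
  unfold fieldVar
  linarith

theorem fieldVar_box_two_pow_le (j : ℕ) (x : Torus) :
    fieldVar (box (2 ^ j)) x ≤
      j * (Real.log 2 / (2 * Real.pi)) + (4 * Real.pi ^ 2)⁻¹ * (1 + 4 * Real.pi) := by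
  rw [fieldVar_box]
  have h := sum_box_inv_lam_le (2 ^ j)
  push_cast at h
  rw [Real.log_pow] at h
  have h2 := mul_le_mul_of_nonneg_left h (by positivity : 0 ≤ (4 * Real.pi ^ 2)⁻¹)
  refine h2.trans (le_of_eq ?_)
  have := Real.pi_ne_zero
  field_simp
  ring

theorem fieldVar_nonneg (F : Finset (ℤ × ℤ)) (x : Torus) : 0 ≤ fieldVar F x :=
  Finset.sum_nonneg fun _ _ => sq_nonneg _

/-! ### The martingale structure of the Wick functionals. -/

/-- `∫ cos (a X(x) + θ) exp ((a²/2) E X(x)²) dx` for the field `X` with modes in `F`. -/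
def wickTrig (θ a : ℝ) (F : Finset (ℤ × ℤ)) : (ℤ × ℤ → ℝ) → ℝ :=
  trigIntegral (fun _ => θ) (fun x => Real.exp (a ^ 2 / 2 * fieldVar F x)) a F

theorem continuous_wickTrig (θ a : ℝ) (F : Finset (ℤ × ℤ)) : Continuous (wickTrig θ a F) :=
  continuous_trigIntegral (by fun_prop) (by fun_prop) a F

theorem exists_abs_wickTrig_le (θ a : ℝ) (F : Finset (ℤ × ℤ)) :
    ∃ B, ∀ w, |wickTrig θ a F w| ≤ B := by
  have hc : Continuous fun x => Real.exp (a ^ 2 / 2 * fieldVar F x) := by fun_prop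
  obtain ⟨M, hM⟩ := isCompact_univ.exists_bound_of_continuousOn hc.continuousOn
  exact ⟨_, abs_trigIntegral_le (fun x => hM x (Set.mem_univ x)) a F⟩

theorem integrable_exp_wickTrig (l θ a : ℝ) (F : Finset (ℤ × ℤ)) :
    Integrable (fun w => Real.exp (l * wickTrig θ a F w)) noise := by
  obtain ⟨B, hB⟩ := exists_abs_wickTrig_le θ a F
  refine integrable_exp_noise (B := |l| * B) (continuous_const.mul (continuous_wickTrig θ a F))
    fun w => ?_
  rw [abs_mul]
  gcongr
  exact hB w

theorem fieldSum_merge_of_disjoint {F S : Finset (ℤ × ℤ)} (h : Disjoint F S)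
    (p : (ℤ × ℤ → ℝ) × (ℤ × ℤ → ℝ)) (x : Torus) :
    fieldSum F (merge S p) x = fieldSum F p.1 x := by
  refine Finset.sum_congr rfl fun k hk => ?_
  rw [merge, if_neg (Finset.disjoint_left.1 h hk)]

theorem wickTrig_merge_of_disjoint (θ a : ℝ) {F S : Finset (ℤ × ℤ)} (h : Disjoint F S)
    (p : (ℤ × ℤ → ℝ) × (ℤ × ℤ → ℝ)) : wickTrig θ a F (merge S p) = wickTrig θ a F p.1 := by
  unfold wickTrig trigIntegral
  simp_rw [fieldSum_merge_of_disjoint h]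

/-- With the modes in `F` frozen, their field becomes part of the phase, and a trigonometric
integral in the modes of `S` alone remains. The density keeps the Wick factor of the whole union. -/
theorem wickTrig_union_merge (θ a : ℝ) {F S : Finset (ℤ × ℤ)} (h : Disjoint F S)
    (p : (ℤ × ℤ → ℝ) × (ℤ × ℤ → ℝ)) : wickTrig θ a (F ∪ S) (merge S p) =
      trigIntegral (fun x => θ + a * fieldSum F p.1 x)
        (fun x => Real.exp (a ^ 2 / 2 * fieldVar (F ∪ S) x)) a S p.2 := by
  have h1 : ∀ x, fieldSum (F ∪ S) (merge S p) x = fieldSum F p.1 x + fieldSum S p.2 x := by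
    intro x
    have h2 : fieldSum S (merge S p) x = fieldSum S p.2 x := by
      refine Finset.sum_congr rfl fun k hk => ?_
      rw [merge, if_pos hk]
    rw [← h2, ← fieldSum_merge_of_disjoint h]
    exact Finset.sum_union h
  unfold wickTrig trigIntegral
  simp_rw [h1, mul_add, ← add_assoc]

/-- The martingale property: variances of disjoint mode sets add, and averaging over `S` cancels
exactly the share of `S` in the Wick factor. -/
theorem integral_trigIntegral_eq_wickTrig (θ a : ℝ) {F S : Finset (ℤ × ℤ)} (h : Disjoint F S)
    (w : ℤ × ℤ → ℝ) : ∫ w', trigIntegral (fun x => θ + a * fieldSum F w x)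
        (fun x => Real.exp (a ^ 2 / 2 * fieldVar (F ∪ S) x)) a S w' ∂noise = wickTrig θ a F w := by
  rw [integral_trigIntegral (by fun_prop) (by fun_prop)]
  unfold wickTrig trigIntegral
  congr 1
  ext x
  have h1 : fieldVar (F ∪ S) x = fieldVar F x + fieldVar S x := Finset.sum_union h
  rw [mul_assoc, ← Real.exp_add, h1]
  congr 2
  ring

theorem integral_merge (S : Finset (ℤ × ℤ)) {f : (ℤ × ℤ → ℝ) → ℝ} (hf : Measurable f)
    (hi : Integrable f noise) :
    Integrable (fun p => f (merge S p)) (noise.prod noise) ∧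
      ∫ w, f w ∂noise = ∫ w, ∫ w', f (merge S (w, w')) ∂noise ∂noise := by
  have hmp := measurePreserving_merge S
  have hi' : Integrable (fun p => f (merge S p)) (noise.prod noise) :=
    (hmp.integrable_comp hi.aestronglyMeasurable).2 hi
  refine ⟨hi', ?_⟩
  conv_lhs => rw [← hmp.map_eq]
  rw [integral_map hmp.measurable.aemeasurable hf.aestronglyMeasurable]
  exact integral_prod _ hi'

/-- Concentration is applied conditionally on the modes in `F`. The phase created by these modes
does not affect the gradient bound, so the constant leaves the outer integral. -/
theorem integral_exp_wickTrig_union_le (θ a : ℝ) {F S : Finset (ℤ × ℤ)} (h : Disjoint F S)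
    {v r : ℝ} (hv : ∀ x, fieldVar (F ∪ S) x ≤ v) (hr : ∀ k ∈ S, (lam k)⁻¹ ≤ r)
    (hr0 : 0 ≤ r) (l : ℝ) :
    ∫ w, Real.exp (l * wickTrig θ a (F ∪ S) w) ∂noise ≤
      Real.exp (Real.pi ^ 2 / 8 * (l ^ 2 * (a ^ 2 * r * (Real.exp (a ^ 2 * v) *
        (4 * Real.pi ^ 2))))) * ∫ w, Real.exp (l * wickTrig θ a F w) ∂noise := by
  have hi := integrable_exp_wickTrig l θ a (F ∪ S)
  obtain ⟨hi', h1⟩ := integral_merge S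
    (f := fun w => Real.exp (l * wickTrig θ a (F ∪ S) w))
    (Real.continuous_exp.comp (continuous_const.mul (continuous_wickTrig θ a (F ∪ S)))).measurable hi
  rw [h1, ← integral_const_mul]
  refine integral_mono hi'.integral_prod_left
    ((integrable_exp_wickTrig l θ a F).const_mul _) fun w => ?_
  change ∫ w', Real.exp (l * wickTrig θ a (F ∪ S) (merge S (w, w'))) ∂noise ≤ _
  simp_rw [wickTrig_union_merge θ a h]
  have h2 := integral_exp_trigIntegral_le (u := fun x => θ + a * fieldSum F w x)
    (ρ := fun x => Real.exp (a ^ 2 / 2 * fieldVar (F ∪ S) x)) (by fun_prop) (by fun_prop) a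
    (S := S) (M := Real.exp (a ^ 2 / 2 * v)) (r := r) (fun x => by
      rw [abs_of_pos (Real.exp_pos _)]
      have := hv x
      gcongr) hr hr0 l
  rw [integral_trigIntegral_eq_wickTrig θ a h, ← Real.exp_nat_mul] at h2
  rw [mul_comm]
  convert h2 using 8
  push_cast
  ring

/-! ### Uniform exponential moments along dyadic boxes. -/

/-- The exponential moments of the cut-off Wick trigonometric functions are bounded uniformly
along dyadic boxes. -/
theorem exists_integral_exp_wickTrig_le (θ : ℝ) {a : ℝ} (ha : a ^ 2 < 4 * Real.pi) (l : ℝ) :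
    ∃ C, ∀ j : ℕ, ∫ w, Real.exp (l * wickTrig θ a (box (2 ^ j)) w) ∂noise ≤ C := by
  set b := Real.log 2 / (2 * Real.pi) with hb
  set c := (4 * Real.pi ^ 2)⁻¹ * (1 + 4 * Real.pi)
  set q := Real.exp (a ^ 2 * b) / 4 with hq
  have hq0 : 0 ≤ q := by positivity
  -- The only use of the threshold: `a² * log 2 / (2π) < 2 * log 2` is equivalent to `a ^ 2 < 4 *
  -- π`.
  have hq1 : q < 1 := by
    have h4 : (4 : ℝ) = Real.exp (2 * Real.log 2) := by
      rw [two_mul, Real.exp_add, Real.exp_log two_pos]; norm_num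
    rw [hq, div_lt_one (by norm_num), h4, Real.exp_lt_exp, hb, ← mul_div_assoc,
      div_lt_iff₀ (by positivity)]
    have := Real.log_pos one_lt_two
    nlinarith
  set K := Real.pi ^ 2 / 8 * (l ^ 2 * (a ^ 2 * (Real.exp (a ^ 2 * (b + c)) * (4 * Real.pi ^ 2))))
  have hK : 0 ≤ K := by positivity
  set I : ℕ → ℝ := fun j => ∫ w, Real.exp (l * wickTrig θ a (box (2 ^ j)) w) ∂noise
  have hI : ∀ j, 0 ≤ I j := fun j => integral_nonneg fun w => (Real.exp_pos _).le
  have hstep : ∀ j, I (j + 1) ≤ Real.exp (K * q ^ j) * I j := by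
    intro j
    have hsub : box (2 ^ j) ⊆ box (2 ^ (j + 1)) := box_mono (Nat.pow_le_pow_right two_pos (by omega))
    have h := integral_exp_wickTrig_union_le θ a (F := box (2 ^ j))
      (S := box (2 ^ (j + 1)) \ box (2 ^ j)) Finset.disjoint_sdiff
      -- The density carries the variance of the larger box, whereas the new modes are only known to
      -- lie outside the smaller one. The extra `b` is absorbed into `K`.
      (v := (j + 1 : ℕ) * b + c) (r := (((2 ^ j : ℕ) : ℝ) ^ 2)⁻¹)
      (fun x => by
        rw [Finset.union_sdiff_of_subset hsub]
        exact fieldVar_box_two_pow_le (j + 1) x)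
      (fun k hk => inv_lam_le_of_notMem_box (by positivity) (Finset.mem_sdiff.1 hk).2)
      (by positivity) l
    rw [Finset.union_sdiff_of_subset hsub] at h
    have e1 : Real.exp (a ^ 2 * (((j + 1 : ℕ) : ℝ) * b + c)) =
        Real.exp (a ^ 2 * (b + c)) * Real.exp (a ^ 2 * b) ^ j := by
      rw [← Real.exp_nat_mul, ← Real.exp_add]
      congr 1
      push_cast
      ring
    have e2 : (((2 ^ j : ℕ) : ℝ) ^ 2)⁻¹ = (1 / 4) ^ j := by
      push_cast
      rw [← pow_mul, mul_comm, pow_mul, ← inv_pow]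
      norm_num
    rw [e1, e2] at h
    convert h using 3
    rw [hq, div_eq_mul_one_div, mul_pow]
    ring
  have hind : ∀ j, I j ≤ Real.exp (K * ∑ i ∈ Finset.range j, q ^ i) * I 0 := by
    intro j
    induction j with
    | zero => simp
    | succ j ih =>
      calc I (j + 1) ≤ Real.exp (K * q ^ j) * I j := hstep j
        _ ≤ Real.exp (K * q ^ j) * (Real.exp (K * ∑ i ∈ Finset.range j, q ^ i) * I 0) := by gcongr
        _ = _ := by
          rw [← mul_assoc, ← Real.exp_add, Finset.sum_range_succ]
          congr 2
          ring
  refine ⟨Real.exp (K * (1 - q)⁻¹) * I 0, fun j => (hind j).trans ?_⟩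
  have h0 := hI 0
  gcongr
  rw [← tsum_geometric_of_lt_one hq0 hq1]
  exact (summable_geometric_of_lt_one hq0 hq1).sum_le_tsum _ fun i _ => by positivity

/-! ### Convergence in `L²` and exponential moments of the limit. -/

theorem memLp_wickTrig (θ a : ℝ) (F : Finset (ℤ × ℤ)) : MemLp (wickTrig θ a F) 2 noise := by
  obtain ⟨B, hB⟩ := exists_abs_wickTrig_le θ a F
  exact MemLp.of_bound (continuous_wickTrig θ a F).measurable.aestronglyMeasurable B (ae_of_all _ hB)

/-- Orthogonality of martingale increments: average over `G \ F` first, which leaves the second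
factor fixed and turns the first into it. -/
theorem integral_wickTrig_mul_of_subset (θ a : ℝ) {F G : Finset (ℤ × ℤ)} (h : F ⊆ G) :
    ∫ w, wickTrig θ a G w * wickTrig θ a F w ∂noise = ∫ w, wickTrig θ a F w ^ 2 ∂noise := by
  have hi : Integrable (fun w => wickTrig θ a G w * wickTrig θ a F w) noise :=
    (memLp_wickTrig θ a G).integrable_mul (memLp_wickTrig θ a F)
  have hu : F ∪ G \ F = G := Finset.union_sdiff_of_subset h
  have hm : Measurable fun w => wickTrig θ a G w * wickTrig θ a F w :=
    (continuous_wickTrig θ a G).measurable.mul (continuous_wickTrig θ a F).measurable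
  rw [(integral_merge (G \ F) hm hi).2]
  congr 1
  ext w
  have h1 : ∀ w', wickTrig θ a G (merge (G \ F) (w, w')) =
      trigIntegral (fun x => θ + a * fieldSum F w x)
        (fun x => Real.exp (a ^ 2 / 2 * fieldVar (F ∪ G \ F) x)) a (G \ F) w' := by
    intro w'
    have := wickTrig_union_merge θ a (Finset.disjoint_sdiff (s := F) (t := G)) (w, w')
    rwa [hu] at this ⊢
  simp_rw [h1, wickTrig_merge_of_disjoint θ a (Finset.disjoint_sdiff (s := F) (t := G))]
  rw [integral_mul_const, integral_trigIntegral_eq_wickTrig θ a Finset.disjoint_sdiff, sq]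

/-- The second moment of `wickTrig`. -/
def wickSq (θ a : ℝ) (F : Finset (ℤ × ℤ)) : ℝ := ∫ w, wickTrig θ a F w ^ 2 ∂noise

theorem integral_wickTrig_sub_sq (θ a : ℝ) {F G : Finset (ℤ × ℤ)} (h : F ⊆ G) :
    ∫ w, (wickTrig θ a G w - wickTrig θ a F w) ^ 2 ∂noise = wickSq θ a G - wickSq θ a F := by
  have h1 : ∀ w, (wickTrig θ a G w - wickTrig θ a F w) ^ 2 = wickTrig θ a G w ^ 2
      - 2 * (wickTrig θ a G w * wickTrig θ a F w) + wickTrig θ a F w ^ 2 := fun w => by ring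
  have i1 := (memLp_wickTrig θ a G).integrable_sq
  have i2 := (memLp_wickTrig θ a F).integrable_sq
  have i3 : Integrable (fun w => wickTrig θ a G w * wickTrig θ a F w) noise :=
    (memLp_wickTrig θ a G).integrable_mul (memLp_wickTrig θ a F)
  simp_rw [h1]
  rw [integral_add (by fun_prop) i2, integral_sub i1 (i3.const_mul 2),
    integral_const_mul, integral_wickTrig_mul_of_subset θ a h]
  unfold wickSq
  ring

theorem monotone_wickSq (θ a : ℝ) : Monotone (wickSq θ a) := by
  intro F G h
  have h1 : 0 ≤ ∫ w, (wickTrig θ a G w - wickTrig θ a F w) ^ 2 ∂noise :=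
    integral_nonneg fun w => sq_nonneg _
  rw [integral_wickTrig_sub_sq θ a h] at h1
  linarith

/-- Since `y² ≤ 2 * exp |y| ≤ 2 * (exp y + exp (-y))`, the exponential moments with `l = 1` and `l =
-1` control the second moment on dyadic boxes; monotonicity extends the bound to every finite set.
-/
theorem bddAbove_range_wickSq (θ : ℝ) {a : ℝ} (ha : a ^ 2 < 4 * Real.pi) :
    BddAbove (Set.range (wickSq θ a)) := by
  obtain ⟨C, hC⟩ := exists_integral_exp_wickTrig_le θ ha 1
  obtain ⟨D, hD⟩ := exists_integral_exp_wickTrig_le θ ha (-1)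
  refine ⟨2 * (C + D), ?_⟩
  rintro _ ⟨F, rfl⟩
  obtain ⟨j, hj⟩ := exists_subset_box F
  refine (monotone_wickSq θ a hj).trans ?_
  have i1 := integrable_exp_wickTrig 1 θ a (box (2 ^ j))
  have i2 := integrable_exp_wickTrig (-1) θ a (box (2 ^ j))
  calc wickSq θ a (box (2 ^ j)) ≤ ∫ w, 2 * (Real.exp (1 * wickTrig θ a (box (2 ^ j)) w) +
        Real.exp (-1 * wickTrig θ a (box (2 ^ j)) w)) ∂noise := by
        refine integral_mono (memLp_wickTrig θ a _).integrable_sq ((i1.add i2).const_mul 2)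
          fun w => ?_
        change wickTrig θ a (box (2 ^ j)) w ^ 2 ≤ _
        generalize wickTrig θ a (box (2 ^ j)) w = y
        have h1 := Real.quadratic_le_exp_of_nonneg (abs_nonneg y)
        rw [sq_abs] at h1
        have h2 : Real.exp |y| ≤ Real.exp (1 * y) + Real.exp (-1 * y) := by
          rw [one_mul, neg_one_mul]
          rcases abs_choice y with h | h <;> rw [h]
          · linarith [Real.exp_pos (-y)]
          · linarith [Real.exp_pos y]
        have := abs_nonneg y
        change y ^ 2 ≤ 2 * (Real.exp (1 * y) + Real.exp (-1 * y))
        linarith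
    _ ≤ 2 * (C + D) := by
        rw [integral_const_mul, integral_add i1 i2]
        have := hC j
        have := hD j
        linarith

/-- The functionals `wickTrig` converge in `L²` along the net of finite sets of modes. -/
theorem exists_tendsto_wickTrig (θ : ℝ) {a : ℝ} (ha : a ^ 2 < 4 * Real.pi) :
    ∃ W : (ℤ × ℤ → ℝ) → ℝ, MemLp W 2 noise ∧
      Tendsto (fun F => eLpNorm (wickTrig θ a F - W) 2 noise) atTop (𝓝 0) := by
  have hlim := tendsto_atTop_ciSup (monotone_wickSq θ a) (bddAbove_range_wickSq θ ha)
  have hcau : CauchySeq fun F => (memLp_wickTrig θ a F).toLp := by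
    -- The squared distance between two nested stages is the increment of the bounded monotone
    -- `wickSq`, hence at most its distance to the supremum.
    refine cauchySeq_of_le_tendsto_0'
      (fun F => Real.sqrt ((⨆ G, wickSq θ a G) - wickSq θ a F)) (fun F G hFG => ?_) ?_
    · rw [dist_comm, dist_eq_norm, ← MemLp.toLp_sub, Lp.norm_toLp,
        ((memLp_wickTrig θ a G).sub (memLp_wickTrig θ a F)).eLpNorm_eq_integral_rpow_norm
          (by norm_num) (by norm_num), ENNReal.toReal_ofReal (by positivity)]
      simp only [ENNReal.toReal_ofNat, Real.rpow_ofNat, Real.norm_eq_abs, sq_abs, Pi.sub_apply]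
      rw [integral_wickTrig_sub_sq θ a hFG, Real.sqrt_eq_rpow, ← one_div]
      have h1 := monotone_wickSq θ a hFG
      have h2 := le_ciSup (bddAbove_range_wickSq θ ha) G
      gcongr
    · have := (hlim.const_sub (⨆ G, wickSq θ a G)).sqrt
      simpa using this
  obtain ⟨W, hW⟩ := cauchySeq_tendsto_of_complete hcau
  refine ⟨W, Lp.memLp W, ?_⟩
  refine ((Lp.tendsto_Lp_iff_tendsto_eLpNorm' _ _).1 hW).congr fun F => ?_
  exact eLpNorm_congr_ae ((memLp_wickTrig θ a F).coeFn_toLp.sub (ae_eq_refl _))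

/-- Fatou's lemma for exponential moments of an `L²` limit. -/
theorem lintegral_exp_le_of_tendsto_eLpNorm {Ω : Type*} [MeasurableSpace Ω] {μ : Measure Ω}
    {f : ℕ → Ω → ℝ} {W : Ω → ℝ} (hf : ∀ n, AEStronglyMeasurable (f n) μ)
    (hW : AEStronglyMeasurable W μ) (h : Tendsto (fun n => eLpNorm (f n - W) 2 μ) atTop (𝓝 0))
    (l C : ℝ) (hC : ∀ n, ∫⁻ ω, ENNReal.ofReal (Real.exp (l * f n ω)) ∂μ ≤ ENNReal.ofReal C) :
    ∫⁻ ω, ENNReal.ofReal (Real.exp (l * W ω)) ∂μ ≤ ENNReal.ofReal C := by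
  obtain ⟨ns, -, hns⟩ :=
    (tendstoInMeasure_of_tendsto_eLpNorm (by norm_num) hf hW h).exists_seq_tendsto_ae
  have hc : Continuous fun y : ℝ => ENNReal.ofReal (Real.exp (l * y)) :=
    ENNReal.continuous_ofReal.comp (by fun_prop)
  calc ∫⁻ ω, ENNReal.ofReal (Real.exp (l * W ω)) ∂μ
      = ∫⁻ ω, liminf (fun n => ENNReal.ofReal (Real.exp (l * f (ns n) ω))) atTop ∂μ := by
        refine lintegral_congr_ae ?_
        filter_upwards [hns] with ω hω
        exact ((hc.tendsto _).comp hω).liminf_eq.symm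
    _ ≤ liminf (fun n => ∫⁻ ω, ENNReal.ofReal (Real.exp (l * f (ns n) ω)) ∂μ) atTop :=
        lintegral_liminf_le' fun n => hc.measurable.comp_aemeasurable (hf (ns n)).aemeasurable
    _ ≤ ENNReal.ofReal C := by
        refine liminf_le_of_frequently_le' (Frequently.of_forall fun n => hC (ns n))

theorem tendsto_box_two_pow : Tendsto (fun j => box (2 ^ j)) atTop atTop := by
  rw [tendsto_atTop]
  intro F
  obtain ⟨j, hj⟩ := exists_subset_box F
  filter_upwards [eventually_ge_atTop j] with i hi
  exact hj.trans (box_mono (Nat.pow_le_pow_right two_pos hi))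

/-- The uniform bound is known only for dyadic boxes, but these are cofinal among the finite sets of
modes, so Fatou along them suffices. -/
theorem integrable_exp_of_tendsto_wickTrig (θ : ℝ) {a : ℝ} (ha : a ^ 2 < 4 * Real.pi)
    {W : (ℤ × ℤ → ℝ) → ℝ} (hW : MemLp W 2 noise)
    (h : Tendsto (fun F => eLpNorm (wickTrig θ a F - W) 2 noise) atTop (𝓝 0)) (l : ℝ) :
    Integrable (fun w => Real.exp (l * W w)) noise := by
  obtain ⟨C, hC⟩ := exists_integral_exp_wickTrig_le θ ha l
  have h1 := lintegral_exp_le_of_tendsto_eLpNorm (f := fun j => wickTrig θ a (box (2 ^ j)))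
    (fun j => (memLp_wickTrig θ a _).1) hW.1 (h.comp tendsto_box_two_pow) l C fun j => by
      rw [← ofReal_integral_eq_lintegral_ofReal (integrable_exp_wickTrig l θ a _)
        (ae_of_all _ fun w => (Real.exp_pos _).le)]
      exact ENNReal.ofReal_le_ofReal (hC j)
  refine ⟨(Real.continuous_exp.comp (continuous_const_mul l)).comp_aestronglyMeasurable hW.1, ?_⟩
  rw [hasFiniteIntegral_iff_ofReal (ae_of_all _ fun w => (Real.exp_pos _).le)]
  exact h1.trans_lt ENNReal.ofReal_lt_top

/-! ### Transfer from the free field to white noise. -/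

/-- The white noise variables of an element of `H^s`. -/
def noiseCoord {s : ℝ} (z : Sobolev s) (k : ℤ × ℤ) : ℝ :=
  lam k ^ (1 / 2 : ℝ) * ((z.coeff k).re + (z.coeff k).im)

/-- The reality condition makes the coordinates at `k` and `-k` proportional to the sum and the
difference of the real and imaginary parts, from which both parts are recovered. -/
theorem coeff_eq_rawCoeff {s : ℝ} (z : Sobolev s) (k : ℤ × ℤ) :
    z.coeff k = rawCoeff (noiseCoord z) k := by
  have h : lam k ^ (-(1 / 2) : ℝ) * lam k ^ (1 / 2 : ℝ) = 1 := by
    rw [← Real.rpow_add (lam_pos k)]; norm_num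
  unfold rawCoeff noiseCoord
  rw [lam_neg, coeff_neg, Complex.conj_re, Complex.conj_im]
  apply Complex.ext
  · simp only [Complex.mul_re, Complex.mul_im, Complex.add_re, Complex.add_im, Complex.ofReal_re,
      Complex.ofReal_im, Complex.I_re, Complex.I_im]
    linear_combination -(z.coeff k).re * h
  · simp only [Complex.mul_re, Complex.mul_im, Complex.add_re, Complex.add_im, Complex.ofReal_re,
      Complex.ofReal_im, Complex.I_re, Complex.I_im]
    linear_combination -(z.coeff k).im * h

/-- The element of `H^{-δ}` representing the functional `z ↦ ∑ k ∈ F, t k * noiseCoord z k`. -/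
def dualCoeff (δ : ℝ) (F : Finset (ℤ × ℤ)) (t : ℤ × ℤ → ℝ) (k : ℤ × ℤ) : ℂ :=
  ((lam k ^ (δ + 1 : ℝ) : ℝ) : ℂ) * rawCoeff (fun k => if k ∈ F then t k else 0) k

theorem dualCoeff_neg (δ : ℝ) (F : Finset (ℤ × ℤ)) (t : ℤ × ℤ → ℝ) (k : ℤ × ℤ) :
    dualCoeff δ F t (-k) = conj (dualCoeff δ F t k) := by
  simp only [dualCoeff, rawCoeff, lam_neg, neg_neg, map_mul, map_add, Complex.conj_ofReal,
    Complex.conj_I]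
  push_cast
  ring

theorem dualCoeff_eq_zero (δ : ℝ) {F : Finset (ℤ × ℤ)} (t : ℤ × ℤ → ℝ) {k : ℤ × ℤ}
    (h : k ∉ F ∪ F.image (fun j => -j)) : dualCoeff δ F t k = 0 := by
  rw [Finset.mem_union, not_or] at h
  have h2 : -k ∉ F := fun h' => h.2 (Finset.mem_image.2 ⟨-k, h', neg_neg k⟩)
  simp [dualCoeff, rawCoeff, h.1, h2]

theorem summable_dualCoeff (δ : ℝ) (F : Finset (ℤ × ℤ)) (t : ℤ × ℤ → ℝ) :
    Summable fun k => lam k ^ (-δ) * ‖dualCoeff δ F t k‖ ^ 2 :=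
  summable_of_ne_finset_zero (s := F ∪ F.image (fun j => -j)) fun k hk => by
    rw [dualCoeff_eq_zero δ t hk]; simp

/-- The element of `H^{-δ}` representing the functional `z ↦ ∑ k ∈ F, t k * noiseCoord z k`. -/
def dualElem (δ : ℝ) (F : Finset (ℤ × ℤ)) (t : ℤ × ℤ → ℝ) : Sobolev (-δ) :=
  ofCoeff (dualCoeff δ F t) (summable_dualCoeff δ F t) (dualCoeff_neg δ F t)

/-- The weight `δ + 1` in `dualCoeff` is chosen so that the powers of `lam k` cancel; the sum of the
real and imaginary parts of `rawCoeff` then returns the entry at `k`. -/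
theorem linCoeff_dualElem (δ : ℝ) (F : Finset (ℤ × ℤ)) (t : ℤ × ℤ → ℝ) (k : ℤ × ℤ) :
    linCoeff (dualElem δ F t) k = if k ∈ F then t k else 0 := by
  have h : lam k ^ (-δ - 1 / 2) * (lam k ^ (δ + 1 : ℝ) * lam k ^ (-(1 / 2) : ℝ)) = 1 := by
    rw [← Real.rpow_add (lam_pos k), ← Real.rpow_add (lam_pos k)]
    ring_nf
    simp
  unfold linCoeff dualElem
  rw [coeff_ofCoeff]
  unfold dualCoeff rawCoeff
  simp only [Complex.mul_re, Complex.mul_im, Complex.add_re, Complex.add_im, Complex.ofReal_re,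
      Complex.ofReal_im, Complex.I_re, Complex.I_im]
  linear_combination (if k ∈ F then t k else 0) * h

theorem innerProd_dualElem (δ : ℝ) (F : Finset (ℤ × ℤ)) (t : ℤ × ℤ → ℝ) (z : Sobolev (-δ)) :
    innerProd (dualElem δ F t) z = ∑ k ∈ F, t k * noiseCoord z k := by
  have hs : HasSum (fun k => linCoeff (dualElem δ F t) k * noiseCoord z k)
      (∑ k ∈ F, t k * noiseCoord z k) := by
    have h : ∑ k ∈ F, t k * noiseCoord z k =
        ∑ k ∈ F, linCoeff (dualElem δ F t) k * noiseCoord z k := by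
      refine Finset.sum_congr rfl fun k hk => ?_
      rw [linCoeff_dualElem, if_pos hk]
    rw [h]
    refine hasSum_sum_of_ne_finset_zero fun k hk => ?_
    rw [linCoeff_dualElem, if_neg hk, zero_mul]
  unfold innerProd
  refine re_tsum_eq hs (fun k => ?_) (innerProd_summable _ _)
  have e1 : lam k ^ (-δ - 1 / 2) * lam k ^ (1 / 2 : ℝ) = lam k ^ (-δ) := by
    rw [← Real.rpow_add (lam_pos k)]; ring_nf
  simp only [linCoeff, noiseCoord, lam_neg, coeff_neg, Complex.conj_re, Complex.conj_im,
    Complex.mul_re, Complex.mul_im, Complex.ofReal_re, Complex.ofReal_im]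
  rw [← e1]
  ring

theorem innerApow_dualElem {δ : ℝ} (hδ : 0 < δ) (F : Finset (ℤ × ℤ)) (t : ℤ × ℤ → ℝ) :
    innerApow (1 + δ) (dualElem δ F t) (dualElem δ F t) = ∑ k ∈ F, t k ^ 2 := by
  have h : ∑ k ∈ F, t k ^ 2 = ∑ k ∈ F, linCoeff (dualElem δ F t) k ^ 2 := by
    refine Finset.sum_congr rfl fun k hk => ?_
    rw [linCoeff_dualElem, if_pos hk]
  rw [h]
  refine (innerApow_eq hδ _).unique (hasSum_sum_of_ne_finset_zero fun k hk => ?_)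
  rw [linCoeff_dualElem, if_neg hk, sq, zero_mul]

instance (δ : ℝ) (hδ : 0 < δ) : IsProbabilityMeasure (freeField δ hδ) :=
  (isFreeField_freeField δ hδ).1

/-- Under the free field the coordinates `noiseCoord` are independent standard Gaussians. -/
theorem measurePreserving_noiseCoord (δ : ℝ) (hδ : 0 < δ) :
    MeasurePreserving (noiseCoord : Sobolev (-δ) → _) (freeField δ hδ) noise := by
  have hm : ∀ k, Measurable fun z : Sobolev (-δ) => noiseCoord z k := by
    intro k
    -- Each coordinate is the pairing with an element of `H^{-δ}`, hence continuous and Borel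
    -- measurable.
    have h := (continuous_innerProd (dualElem δ {k} fun _ => 1)).measurable
    simpa [innerProd_dualElem] using h
  refine ⟨measurable_pi_lambda _ hm, ?_⟩
  refine map_eq_infinitePi_gaussianReal hm fun F t => ?_
  have h := (isFreeField_freeField δ hδ).2 (dualElem δ F t)
  simpa only [innerProd_dualElem, innerApow_dualElem hδ] using h

/-! ### Cut-off sets and their finite sets of modes. -/

theorem finite_cutoff {Λ : Set (ℝ × ℝ)} (hΛ : IsCompact Λ) :
    {k : ℤ × ℤ | ((k.1 : ℝ), (k.2 : ℝ)) ∈ Λ}.Finite := by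
  obtain ⟨R, hR⟩ := hΛ.isBounded.subset_closedBall (0 : ℝ × ℝ)
  obtain ⟨n, hn⟩ := exists_nat_ge R
  refine (box n).finite_toSet.subset fun k hk => ?_
  have h := hR hk
  rw [Metric.mem_closedBall, dist_zero_right, Prod.norm_def, max_le_iff, Real.norm_eq_abs,
    Real.norm_eq_abs] at h
  rw [Finset.mem_coe, mem_box]
  constructor
  · have h1 : |(k.1 : ℝ)| ≤ n := h.1.trans hn
    exact_mod_cast h1
  · have h1 : |(k.2 : ℝ)| ≤ n := h.2.trans hn
    exact_mod_cast h1

/-- The integer modes in a compact set. -/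
def cutoffModes {Λ : Set (ℝ × ℝ)} (hΛ : IsCompact Λ) : Finset (ℤ × ℤ) := (finite_cutoff hΛ).toFinset

theorem mem_cutoffModes {Λ : Set (ℝ × ℝ)} (hΛ : IsCompact Λ) {k : ℤ × ℤ} :
    k ∈ cutoffModes hΛ ↔ ((k.1 : ℝ), (k.2 : ℝ)) ∈ Λ := by
  simp [cutoffModes]

/-- The real part of each Fourier term is the average of the real terms at `k` and `-k`; summing
over a symmetric set removes the averaging. -/
theorem proj_eq_fieldSum {s : ℝ} {Λ : Set (ℝ × ℝ)} (hΛ : IsCompact Λ) (hs : -Λ = Λ) (z : Sobolev s)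
    (x : Torus) : proj Λ z x = fieldSum (cutoffModes hΛ) (noiseCoord z) x := by
  have hsym : ∀ k, -k ∈ cutoffModes hΛ ↔ k ∈ cutoffModes hΛ := by
    intro k
    rw [mem_cutoffModes, mem_cutoffModes]
    conv_rhs => rw [← hs]
    simp
  have h1 : projSum Λ z x = ∑ k ∈ cutoffModes hΛ, z.coeff k * e k x := by
    unfold projSum
    rw [tsum_eq_sum (s := cutoffModes hΛ) fun k hk => by
      rw [mem_cutoffModes] at hk
      rw [Set.indicator_of_notMem hk, zero_mul, zero_mul]]
    refine Finset.sum_congr rfl fun k hk => ?_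
    rw [mem_cutoffModes] at hk
    rw [Set.indicator_of_mem hk, one_mul]
  have h2 : ∀ k, (z.coeff k * e k x).re =
      (modeFun k x * noiseCoord z k + modeFun (-k) x * noiseCoord z (-k)) / 2 := by
    intro k
    rw [coeff_eq_rawCoeff]
    unfold modeFun hartley rawCoeff
    rw [lam_neg, ← conj_e]
    simp only [Complex.mul_re, Complex.mul_im, Complex.add_re, Complex.add_im, Complex.ofReal_re,
      Complex.ofReal_im, Complex.I_re, Complex.I_im, Complex.conj_re, Complex.conj_im]
    ring
  have h3 : ∑ k ∈ cutoffModes hΛ, modeFun (-k) x * noiseCoord z (-k) =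
      ∑ k ∈ cutoffModes hΛ, modeFun k x * noiseCoord z k :=
    Finset.sum_equiv (Equiv.neg (ℤ × ℤ)) (fun k => (hsym k).symm) fun k _ => rfl
  unfold proj
  rw [h1, Complex.re_sum, Finset.sum_congr rfl fun k _ => h2 k, ← Finset.sum_div,
    Finset.sum_add_distrib, h3]
  unfold fieldSum
  ring

theorem integral_fieldSum_sq (F : Finset (ℤ × ℤ)) (x : Torus) :
    ∫ w, fieldSum F w x ^ 2 ∂noise = fieldVar F x := by
  have hm : Measurable fun w => fieldSum F w x := (continuous_fieldSum_left F x).measurable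
  have hmap : noise.map (fun w => fieldSum F w x) = gaussianReal 0 (fieldVar F x).toNNReal :=
    map_finset_sum (fun k => modeFun k x) F
  have h1 : ∫ w, fieldSum F w x ^ 2 ∂noise = ∫ y, y ^ 2 ∂(noise.map fun w => fieldSum F w x) :=
    (integral_map hm.aemeasurable (f := fun y : ℝ => y ^ 2) (by fun_prop)).symm
  have hv := variance_id_gaussianReal (μ := 0) (v := (fieldVar F x).toNNReal)
  rw [variance_of_integral_eq_zero (by fun_prop) (by simp [integral_id_gaussianReal])] at hv
  rw [h1, hmap]
  simp only [id] at hv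
  rw [hv, Real.coe_toNNReal _ (fieldVar_nonneg F x)]

theorem projVar_eq_fieldVar {δ : ℝ} (hδ : 0 < δ) {Λ : Set (ℝ × ℝ)} (hΛ : IsCompact Λ) (hs : -Λ = Λ)
    (x : Torus) : projVar δ hδ Λ x = fieldVar (cutoffModes hΛ) x := by
  have hmp := measurePreserving_noiseCoord δ hδ
  have hm : Measurable fun w => fieldSum (cutoffModes hΛ) w x ^ 2 :=
    (continuous_fieldSum_left _ x).measurable.pow_const 2
  unfold projVar
  simp_rw [proj_eq_fieldSum hΛ hs]
  rw [← integral_fieldSum_sq]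
  conv_rhs => rw [← hmp.map_eq]
  rw [integral_map hmp.measurable.aemeasurable hm.aestronglyMeasurable]

theorem cosCutoff_eq_wickTrig {δ : ℝ} (hδ : 0 < δ) (a : ℝ) {Λ : Set (ℝ × ℝ)} (hΛ : IsCompact Λ)
    (hs : -Λ = Λ) (z : Sobolev (-δ)) :
    cosCutoff δ hδ a (fun _ => 1) Λ z = wickTrig 0 a (cutoffModes hΛ) (noiseCoord z) := by
  unfold cosCutoff wickTrig trigIntegral
  simp_rw [proj_eq_fieldSum hΛ hs, projVar_eq_fieldVar hδ hΛ hs, mul_one, zero_add]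

/-- The sine is the cosine shifted by the phase `-π/2`, so all estimates with a general `θ` apply.
-/
theorem sinCutoff_eq_wickTrig {δ : ℝ} (hδ : 0 < δ) (a : ℝ) {Λ : Set (ℝ × ℝ)} (hΛ : IsCompact Λ)
    (hs : -Λ = Λ) (z : Sobolev (-δ)) : sinCutoff δ hδ a (fun _ => 1) Λ z =
      wickTrig (-(Real.pi / 2)) a (cutoffModes hΛ) (noiseCoord z) := by
  unfold sinCutoff wickTrig trigIntegral
  simp_rw [proj_eq_fieldSum hΛ hs, projVar_eq_fieldVar hδ hΛ hs, mul_one, neg_add_eq_sub,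
    Real.cos_sub_pi_div_two]

theorem IsCutoff.smul_nat {Λ : Set (ℝ × ℝ)} (h : IsCutoff Λ) (N : ℕ) :
    IsCompact ((N : ℝ) • Λ) ∧ -((N : ℝ) • Λ) = (N : ℝ) • Λ :=
  ⟨h.1.smul _, by rw [← Set.smul_set_neg, h.2.1]⟩

/-- A ball of radius `r` about 0 lies in `Λ`, so `N • Λ` contains the box of size `2 ^ j` as soon as
`N > 2 ^ j / r`. Net convergence thus covers every shape `Λ`, and the limit does not depend on it.
-/
theorem IsCutoff.tendsto_cutoffModes {Λ : Set (ℝ × ℝ)} (h : IsCutoff Λ) :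
    Tendsto (fun N : ℕ => cutoffModes (h.smul_nat N).1) atTop atTop := by
  rw [tendsto_atTop]
  intro F
  obtain ⟨j, hj⟩ := exists_subset_box F
  obtain ⟨r, hr, hrΛ⟩ := Metric.isOpen_iff.1 isOpen_interior (0 : ℝ × ℝ) h.2.2
  obtain ⟨n, hn⟩ := exists_nat_gt (((2 ^ j : ℕ) : ℝ) / r)
  filter_upwards [eventually_ge_atTop n] with N hN k hk
  have hk' := mem_box.1 (hj hk)
  have hnN : (n : ℝ) ≤ N := by exact_mod_cast hN
  have hN0 : (0 : ℝ) < N := (by positivity : (0 : ℝ) ≤ ((2 ^ j : ℕ) : ℝ) / r).trans_lt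
    (hn.trans_le hnN)
  have hlt : ((2 ^ j : ℕ) : ℝ) < r * N := by
    rw [div_lt_iff₀ hr] at hn
    nlinarith
  rw [mem_cutoffModes, Set.mem_smul_set_iff_inv_smul_mem₀ hN0.ne']
  refine interior_subset (hrΛ ?_)
  rw [Metric.mem_ball, dist_zero_right, norm_smul, norm_inv, Real.norm_of_nonneg hN0.le,
    inv_mul_lt_iff₀ hN0, Prod.norm_def, max_lt_iff, Real.norm_eq_abs, Real.norm_eq_abs, mul_comm]
  constructor
  · have h1 : |(k.1 : ℝ)| ≤ (2 ^ j : ℕ) := by exact_mod_cast hk'.1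
    exact h1.trans_lt hlt
  · have h1 : |(k.2 : ℝ)| ≤ (2 ^ j : ℕ) := by exact_mod_cast hk'.2
    exact h1.trans_lt hlt

/-- The square `[-1, 1]²`. -/
theorem isCutoff_closedBall : IsCutoff (Metric.closedBall (0 : ℝ × ℝ) 1) := by
  refine ⟨isCompact_closedBall _ _, by simp, ?_⟩
  exact Metric.ball_subset_interior_closedBall (Metric.mem_ball_self one_pos)

/-! ### Cut-off limits and their exponential moments. -/

/-- Limits in measure are unique almost everywhere, and a single cut-off, the square, already
determines the limit. -/
theorem IsCutoffLimit.ae_eq {δ : ℝ} {hδ : 0 < δ} {F : Set (ℝ × ℝ) → Sobolev (-δ) → ℝ}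
    {W W' : Sobolev (-δ) → ℝ} (hF : ∀ Λ, IsCutoff Λ → ∀ N : ℕ,
      AEStronglyMeasurable (F ((N : ℝ) • Λ)) (freeField δ hδ))
    (h : IsCutoffLimit δ hδ F W) (h' : IsCutoffLimit δ hδ F W') : W =ᵐ[freeField δ hδ] W' := by
  have t1 := tendstoInMeasure_of_tendsto_eLpNorm (by norm_num) (hF _ isCutoff_closedBall) h.1.1
    (h.2 _ isCutoff_closedBall)
  have t2 := tendstoInMeasure_of_tendsto_eLpNorm (by norm_num) (hF _ isCutoff_closedBall) h'.1.1
    (h'.2 _ isCutoff_closedBall)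
  exact tendstoInMeasure_ae_unique t1 t2

/-- Cut-off limits of the Wick trigonometric functions exist and have all exponential moments. -/
theorem cutoffLimit_wickTrig {δ : ℝ} (hδ : 0 < δ) (θ : ℝ) {a : ℝ} (ha : a ^ 2 < 4 * Real.pi)
    {F : Set (ℝ × ℝ) → Sobolev (-δ) → ℝ} (hF : ∀ (Λ : Set (ℝ × ℝ)) (hΛ : IsCompact Λ), -Λ = Λ →
      ∀ z, F Λ z = wickTrig θ a (cutoffModes hΛ) (noiseCoord z)) :
    (∃ W, IsCutoffLimit δ hδ F W) ∧ ∀ W, IsCutoffLimit δ hδ F W →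
      (∀ p : ℝ, 1 ≤ p →
        MemLp (fun z => Real.exp (-W z)) (ENNReal.ofReal p) (freeField δ hδ) ∧
        Integrable (fun z => Real.exp (-(p * W z))) (freeField δ hδ)) ∧
      0 < ∫ z, Real.exp (-W z) ∂(freeField δ hδ) := by
  have hmp := measurePreserving_noiseCoord δ hδ
  obtain ⟨W₀, hW₀, hlim⟩ := exists_tendsto_wickTrig θ ha
  have hF' : ∀ Λ (h : IsCutoff Λ) (N : ℕ),
      F ((N : ℝ) • Λ) = wickTrig θ a (cutoffModes (h.smul_nat N).1) ∘ noiseCoord :=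
    fun Λ h N => funext fun z => hF _ (h.smul_nat N).1 (h.smul_nat N).2 z
  have hmeas : ∀ Λ, IsCutoff Λ → ∀ N : ℕ,
      AEStronglyMeasurable (F ((N : ℝ) • Λ)) (freeField δ hδ) := by
    intro Λ h N
    rw [hF' Λ h N]
    exact ((memLp_wickTrig θ a _).comp_measurePreserving hmp).1
  have hex : IsCutoffLimit δ hδ F (W₀ ∘ noiseCoord) := by
    refine ⟨hW₀.comp_measurePreserving hmp, fun Λ h => ?_⟩
    refine (hlim.comp h.tendsto_cutoffModes).congr fun N => ?_
    rw [hF' Λ h N]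
    exact (eLpNorm_comp_measurePreserving ((memLp_wickTrig θ a _).sub hW₀).1 hmp).symm
  refine ⟨⟨_, hex⟩, fun W hW => ?_⟩
  -- Every version of the limit agrees almost everywhere with the one built from white noise, so it
  -- inherits the exponential moments.
  have hae := hW.ae_eq hmeas hex
  have hint : ∀ l : ℝ, Integrable (fun z => Real.exp (l * W z)) (freeField δ hδ) := by
    intro l
    have h1 := integrable_exp_of_tendsto_wickTrig θ ha hW₀ hlim l
    refine ((hmp.integrable_comp h1.aestronglyMeasurable).2 h1).congr ?_
    filter_upwards [hae] with z hz
    rw [hz]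
    rfl
  have h1 : Integrable (fun z => Real.exp (-W z)) (freeField δ hδ) := by
    simpa only [neg_one_mul] using hint (-1)
  refine ⟨fun p hp => ?_, integral_exp_pos h1⟩
  have h2 : Integrable (fun z => Real.exp (-(p * W z))) (freeField δ hδ) := by
    simpa only [neg_mul] using hint (-p)
  refine ⟨?_, h2⟩
  have hp0 : 0 < p := by linarith
  -- Membership in `L^p` reduces to the exponential moment with `l = -p`.
  rw [← integrable_norm_rpow_iff h1.aestronglyMeasurable (by simpa using hp0) ENNReal.ofReal_ne_top]
  refine h2.congr (ae_of_all _ fun z => ?_)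
  simp only
  rw [Real.norm_of_nonneg (Real.exp_pos _).le, ENNReal.toReal_ofReal hp0.le, ← Real.exp_mul]
  congr 1
  ring

end

end WickTrig

theorem proposition3p4 (δ : ℝ) (hδ : 0 < δ) (a : ℝ) (ha : |a| < Real.sqrt (4 * Real.pi)) :
    ((∃ W, WickTrig.IsWickCos δ hδ a (fun _ => 1) W) ∧
      ∀ W, WickTrig.IsWickCos δ hδ a (fun _ => 1) W →
        (∀ p : ℝ, 1 ≤ p →
          MemLp (fun z => Real.exp (-W z)) (ENNReal.ofReal p) (WickTrig.freeField δ hδ) ∧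
          Integrable (fun z => Real.exp (-(p * W z))) (WickTrig.freeField δ hδ)) ∧
        0 < ∫ z, Real.exp (-W z) ∂(WickTrig.freeField δ hδ)) ∧
    ((∃ W, WickTrig.IsWickSin δ hδ a (fun _ => 1) W) ∧
      ∀ W, WickTrig.IsWickSin δ hδ a (fun _ => 1) W →
        (∀ p : ℝ, 1 ≤ p →
          MemLp (fun z => Real.exp (-W z)) (ENNReal.ofReal p) (WickTrig.freeField δ hδ) ∧
          Integrable (fun z => Real.exp (-(p * W z))) (WickTrig.freeField δ hδ)) ∧
        0 < ∫ z, Real.exp (-W z) ∂(WickTrig.freeField δ hδ)) := by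
  have ha2 : a ^ 2 < 4 * Real.pi := by
    rw [← sq_abs, ← Real.sq_sqrt (by positivity : 0 ≤ 4 * Real.pi)]
    gcongr
  exact ⟨WickTrig.cutoffLimit_wickTrig hδ 0 ha2 fun _ hΛ hs z =>
      WickTrig.cosCutoff_eq_wickTrig hδ a hΛ hs z,
    WickTrig.cutoffLimit_wickTrig hδ _ ha2 fun _ hΛ hs z =>
      WickTrig.sinCutoff_eq_wickTrig hδ a hΛ hs z⟩
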